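/- Let $d,N\in\mathbb N_0$, let $\mathcal S=\mathcal S(\mathbb R^d,\mathbb C^N)$ be the space of Schwartz functions, and for $n\in\mathbb N_0$ let $\mathcal S^{\otimes n}=\mathcal S\big((\mathbb R^d)^n,(\mathbb C^N)^{\otimes n}\big)$ be its (completed) $n$-fold tensor power. Let $W_n$ ($n\in\mathbb N_0$) and $W_n^T$ ($n\in\mathbb N$) be continuous linear functionals on $\mathcal S^{\otimes n}$, where $\{W_n^T\}$ is the truncation of $\{W_n\}$: for all $n\ge 1$ and $f_1,\dots,f_n\in\mathcal S$, $$W_n(f_1\otimes\cdots\otimes f_n)=\sum_{I\in\mathcal P^{(n)}}\ \prod_{\substack{\{j_1,\dots,j_l\}\in I\\ j_1<\cdots<j_l}}W_l^T(f_{j_1}\otimes\cdots\otimes f_{j_l}),$$ where $\mathcal P^{(n)}$ is the set of all partitions of $\{1,\dots,n\}$ into disjoint nonempty sets. Suppose there is one norm $\|\cdot\|$ on $\mathcal S$, continuous for the Schwartz topology, such that for every $n\ge 1$ the functional $W_n^T$ is continuous with respect to $\|\cdot\|^{\otimes n}$, i.e. there is $C_n<\infty$ with $|W_n^T(F)|\le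 C_n\|F\|^{\otimes n}$ for all $F$ in the algebraic $n$-fold tensor power of $\mathcal S$ (the linear span of the products $f_1\otimes\cdots\otimes f_n$), where $$\|F\|^{\otimes n}=\inf\Big\{\sum_{j}|c_j|\,\|f_{j,1}\|\cdots\|f_{j,n}\| \;:\; F=\sum_{j}c_j\, f_{j,1}\otimes\cdots\otimes f_{j,n}\ \text{(finite sum)}\Big\}$$ is the projective tensor norm. Then $\{W_n\}$ satisfies the Hilbert space structure condition: for every $n\in\mathbb N_0$ there is a Hilbert seminorm $p_n$ on $\mathcal S^{\otimes n}$ (a continuous seminorm with $p_n(f)^2=\langle f,f\rangle_n$ for some positive semidefinite Hermitian sesquilinear form $\langle\cdot,\cdot\rangle_n$) such that $$|W_{n+m}(f\otimes h)|\le p_n(f)\,p_m(h)\qquad\text{for all } n,m\in\mathbb N_0,\ f\in\mathcal S^{\otimes n},\ h\in\mathcal S^{\otimes m}.$$ -/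

import Mathlib

open scoped SchwartzMap ContDiff

noncomputable section

namespace Wightman

/-- Space-time `ℝ^d`. -/
abbrev Spacetime (d : ℕ) : Type := EuclideanSpace ℝ (Fin d)

/-- The one-particle test function space `𝒮 = 𝒮(ℝ^d, ℂ^N)`. -/
abbrev TestFun (d N : ℕ) : Type := 𝓢(Spacetime d, EuclideanSpace ℂ (Fin N))

/-- `n`-point configurations `(x_1, …, x_n) ∈ (ℝ^d)^n`. -/
abbrev Config (d n : ℕ) : Type := PiLp 2 (fun _ : Fin n => Spacetime d)

/-- The coefficient space `(ℂ^N)^{⊗ n}`; a tensor is given by its components, which are indexed by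
multi-indices `α = (α_1, …, α_n)`. -/
abbrev Coeff (N n : ℕ) : Type := EuclideanSpace ℂ (Fin n → Fin N)

/-- The (completed) `n`-fold tensor power of `𝒮`, i.e. `𝒮((ℝ^d)^n, (ℂ^N)^{⊗ n})`. -/
abbrev TensorTestFun (d N n : ℕ) : Type := 𝓢(Config d n, Coeff N n)

section Outer

variable {E E₁ E₂ F₁ F₂ G : Type*}
  [NormedAddCommGroup E] [NormedSpace ℝ E]
  [NormedAddCommGroup E₁] [NormedSpace ℝ E₁] [NormedAddCommGroup E₂] [NormedSpace ℝ E₂]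
  [NormedAddCommGroup F₁] [NormedSpace ℝ F₁] [NormedAddCommGroup F₂] [NormedSpace ℝ F₂]
  [NormedAddCommGroup G] [NormedSpace ℝ G]

theorem norm_iteratedFDeriv_comp_le (P : E →L[ℝ] E₁) (f : 𝓢(E₁, F₁)) (j : ℕ) (x : E) :
    ‖iteratedFDeriv ℝ j (fun y => f (P y)) x‖ ≤ ‖iteratedFDeriv ℝ j f (P x)‖ * ‖P‖ ^ j := by
  have h := P.iteratedFDeriv_comp_right (f.smooth ⊤) x (i := j) (mod_cast le_top)
  change ‖iteratedFDeriv ℝ j (f ∘ P) x‖ ≤ _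
  rw [h]
  refine (ContinuousMultilinearMap.norm_compContinuousLinearMap_le _ _).trans ?_
  simp

variable [FiniteDimensional ℝ E]

theorem exists_norm_le_of_ker (P : E →L[ℝ] E₁) (Q : E →L[ℝ] E₂)
    (hPQ : ∀ x, P x = 0 → Q x = 0 → x = 0) :
    ∃ K : ℝ, 0 ≤ K ∧ ∀ x, ‖x‖ ≤ K * max ‖P x‖ ‖Q x‖ := by
  have hker : LinearMap.ker ((P.prod Q : E →L[ℝ] E₁ × E₂) : E →ₗ[ℝ] E₁ × E₂) = ⊥ := by
    rw [LinearMap.ker_eq_bot']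
    intro x hx
    have hx' : (P x, Q x) = 0 := hx
    exact hPQ x (congrArg Prod.fst hx') (congrArg Prod.snd hx')
  obtain ⟨K, -, hK⟩ := LinearMap.exists_antilipschitzWith _ hker
  refine ⟨K, K.2, fun x => ?_⟩
  have := hK.le_mul_dist x 0
  simpa [dist_eq_norm, Prod.norm_def] using this

/-- The Schwartz function `x ↦ B (f (P x)) (h (Q x))`, where `P, Q` are linear maps that jointly
separate points and `B` is bilinear. -/
def outer (P : E →L[ℝ] E₁) (Q : E →L[ℝ] E₂) (hPQ : ∀ x, P x = 0 → Q x = 0 → x = 0)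
    (B : F₁ →L[ℝ] F₂ →L[ℝ] G) (f : 𝓢(E₁, F₁)) (h : 𝓢(E₂, F₂)) : 𝓢(E, G) where
  toFun x := B (f (P x)) (h (Q x))
  smooth' := (B.isBoundedBilinearMap.contDiff).comp₂
    ((f.smooth ⊤).comp P.contDiff) ((h.smooth ⊤).comp Q.contDiff)
  decay' k n := by
    obtain ⟨K, hK0, hK⟩ := exists_norm_le_of_ker P Q hPQ
    choose Cf hCf using f.decay
    choose Ch hCh using h.decay
    refine ⟨‖B‖ * ∑ i ∈ Finset.range (n + 1), K ^ k * (n.choose i * (‖P‖ ^ i * ‖Q‖ ^ (n - i) *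
      (Cf k i * Ch 0 (n - i) + Cf 0 i * Ch k (n - i)))), fun x => ?_⟩
    have hb := B.norm_iteratedFDeriv_le_of_bilinear (N := ∞)
      (f := fun x => f (P x)) (g := fun x => h (Q x))
      ((f.smooth ⊤).comp P.contDiff) ((h.smooth ⊤).comp Q.contDiff) x (n := n) (mod_cast le_top)
    refine (mul_le_mul_of_nonneg_left hb (by positivity)).trans ?_
    rw [mul_left_comm, Finset.mul_sum]
    refine mul_le_mul_of_nonneg_left (Finset.sum_le_sum fun i _ => ?_) B.opNorm_nonneg
    set a := ‖iteratedFDeriv ℝ i f (P x)‖ with ha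
    set b := ‖iteratedFDeriv ℝ (n - i) h (Q x)‖ with hb'
    have ha0 : 0 ≤ a := norm_nonneg _
    have hb0 : 0 ≤ b := norm_nonneg _
    have h1 := norm_iteratedFDeriv_comp_le P f i x
    have h2 := norm_iteratedFDeriv_comp_le Q h (n - i) x
    have hx : ‖x‖ ^ k ≤ K ^ k * (‖P x‖ ^ k + ‖Q x‖ ^ k) := by
      refine (pow_le_pow_left₀ (norm_nonneg _) (hK x) k).trans ?_
      rw [mul_pow]
      refine mul_le_mul_of_nonneg_left ?_ (by positivity)
      rcases max_choice ‖P x‖ ‖Q x‖ with e | e <;> rw [e]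
      · exact le_add_of_nonneg_right (by positivity)
      · exact le_add_of_nonneg_left (by positivity)
    have f1 : ‖P x‖ ^ k * a ≤ Cf k i := (hCf k i).2 (P x)
    have f0 : a ≤ Cf 0 i := by simpa using (hCf 0 i).2 (P x)
    have g1 : ‖Q x‖ ^ k * b ≤ Ch k (n - i) := (hCh k (n - i)).2 (Q x)
    have g0 : b ≤ Ch 0 (n - i) := by simpa using (hCh 0 (n - i)).2 (Q x)
    calc ‖x‖ ^ k * (n.choose i * ‖iteratedFDeriv ℝ i (fun x => f (P x)) x‖ *
          ‖iteratedFDeriv ℝ (n - i) (fun x => h (Q x)) x‖)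
        ≤ (K ^ k * (‖P x‖ ^ k + ‖Q x‖ ^ k)) *
          (n.choose i * (a * ‖P‖ ^ i) * (b * ‖Q‖ ^ (n - i))) := by gcongr
      _ = K ^ k * (n.choose i * (‖P‖ ^ i * ‖Q‖ ^ (n - i) *
          ((‖P x‖ ^ k * a) * b + a * (‖Q x‖ ^ k * b)))) := by ring
      _ ≤ _ := by
        have : 0 ≤ Cf k i := le_trans (by positivity) f1
        have : 0 ≤ Cf 0 i := le_trans (by positivity) f0
        gcongr

@[simp]
theorem outer_apply (P : E →L[ℝ] E₁) (Q : E →L[ℝ] E₂) (hPQ : ∀ x, P x = 0 → Q x = 0 → x = 0)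
    (B : F₁ →L[ℝ] F₂ →L[ℝ] G) (f : 𝓢(E₁, F₁)) (h : 𝓢(E₂, F₂)) (x : E) :
    outer P Q hPQ B f h x = B (f (P x)) (h (Q x)) := rfl

end Outer

/-- Restriction of a configuration along a map of labels. -/
def Config.pull (d : ℕ) {n k : ℕ} (e : Fin k → Fin n) : Config d n →L[ℝ] Config d k :=
  ((PiLp.continuousLinearEquiv 2 ℝ (fun _ : Fin k => Spacetime d)).symm :
      (Fin k → Spacetime d) →L[ℝ] Config d k).comp
    (ContinuousLinearMap.pi fun i =>
      (PiLp.proj 2 (fun _ : Fin n => Spacetime d) (e i) : Config d n →L[ℝ] Spacetime d))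

@[simp]
theorem Config.pull_apply (d : ℕ) {n k : ℕ} (e : Fin k → Fin n) (x : Config d n) (i : Fin k) :
    Config.pull d e x i = x (e i) := rfl

/-- For maps `a, b` of index sets: the bilinear map sending `u, v` to the vector with components `u (a α) * v (b α)`. -/
def mulComponents {ι κ μ : Type} [Fintype ι] [Fintype κ] [Fintype μ] (a : μ → ι) (b : μ → κ) :
    EuclideanSpace ℂ ι →L[ℝ] EuclideanSpace ℂ κ →L[ℝ] EuclideanSpace ℂ μ :=
  (LinearMap.mk₂ ℝ
    (fun (u : EuclideanSpace ℂ ι) (v : EuclideanSpace ℂ κ) =>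
      (WithLp.toLp 2 fun α => u (a α) * v (b α) : EuclideanSpace ℂ μ))
    (fun u u' v => by ext α; simp [add_mul])
    (fun c u v => by ext α; simp [mul_assoc])
    (fun u v v' => by ext α; simp [mul_add])
    (fun c u v => by ext α; simp [mul_left_comm])).toContinuousBilinearMap

@[simp]
theorem mulComponents_apply {ι κ μ : Type} [Fintype ι] [Fintype κ] [Fintype μ]
    (a : μ → ι) (b : μ → κ) (u : EuclideanSpace ℂ ι) (v : EuclideanSpace ℂ κ) (α : μ) :
    mulComponents a b u v α = u (a α) * v (b α) := rfl

/-- The tensor product `f ⊗ h` of `f ∈ 𝒮^{⊗ n}` and `h ∈ 𝒮^{⊗ m}`. -/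
def tensor {d N n m : ℕ} (f : TensorTestFun d N n) (h : TensorTestFun d N m) :
    TensorTestFun d N (n + m) :=
  outer (Config.pull d (Fin.castAdd m)) (Config.pull d (Fin.natAdd n))
    (fun x h₁ h₂ => by
      ext1 i
      refine Fin.addCases (fun j => ?_) (fun j => ?_) i
      · exact congrArg (fun y : Config d n => y j) h₁
      · exact congrArg (fun y : Config d m => y j) h₂)
    (mulComponents (fun α i => α (Fin.castAdd m i)) (fun α i => α (Fin.natAdd n i))) f h

theorem tensor_apply {d N n m : ℕ} (f : TensorTestFun d N n) (h : TensorTestFun d N m)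
    (x : Config d (n + m)) (α : Fin (n + m) → Fin N) :
    tensor f h x α =
      f (WithLp.toLp 2 fun i => x (Fin.castAdd m i)) (fun i => α (Fin.castAdd m i)) *
      h (WithLp.toLp 2 fun i => x (Fin.natAdd n i)) (fun i => α (Fin.natAdd n i)) := rfl

/-- The product test function `f_1 ⊗ ⋯ ⊗ f_n` of `f_1, …, f_n ∈ 𝒮`; see `tensorProd_apply` for its
values. -/
def tensorProd {d N : ℕ} : {n : ℕ} → (Fin n → TestFun d N) → TensorTestFun d N n
  | 0, _ => HasCompactSupport.toSchwartzMap
      (f := fun _ : Config d 0 => (WithLp.toLp 2 fun _ => 1 : Coeff N 0))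
      (HasCompactSupport.of_compactSpace _) contDiff_const
  | n + 1, f =>
      outer (Config.pull d (Fin.castSucc (n := n)))
        (PiLp.proj 2 (fun _ : Fin (n + 1) => Spacetime d) (Fin.last n) :
          Config d (n + 1) →L[ℝ] Spacetime d)
        (fun x h₁ h₂ => by
          ext1 i
          refine Fin.lastCases ?_ (fun j => ?_) i
          · exact h₂
          · exact congrArg (fun y : Config d n => y j) h₁)
        (mulComponents (fun α i => α (Fin.castSucc i)) (fun α => α (Fin.last n)))
        (tensorProd fun i => f i.castSucc) (f (Fin.last n))

theorem tensorProd_apply {d N : ℕ} : ∀ {n : ℕ} (f : Fin n → TestFun d N) (x : Config d n)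
    (α : Fin n → Fin N), tensorProd f x α = ∏ i, f i (x i) (α i)
  | 0, _, _, _ => by simp [tensorProd]
  | n + 1, f, x, α => by
      rw [Fin.prod_univ_castSucc, tensorProd, outer_apply, mulComponents_apply, tensorProd_apply]
      rfl

/-- A Schwartz norm: a norm on `𝒮` that is continuous for the Schwartz topology. -/
structure IsSchwartzNorm {d N : ℕ} (p : Seminorm ℂ (TestFun d N)) : Prop where
  continuous : Continuous p
  definite : ∀ f, p f = 0 → f = 0

/-- The algebraic tensor power of `𝒮`, realized as a subspace of `𝒮((ℝ^d)^n, (ℂ^N)^{⊗ n})`. -/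
def algTensor (d N n : ℕ) : Submodule ℂ (TensorTestFun d N n) :=
  Submodule.span ℂ (Set.range (tensorProd (d := d) (N := N) (n := n)))

/-- The tensor norm `‖·‖^{⊗ n}` (projective, i.e. the largest cross norm) on the algebraic tensor
power: the infimum of `∑_j |c_j| ‖f_{j,1}‖ ⋯ ‖f_{j,n}‖` over all finite representations
`F = ∑_j c_j f_{j,1} ⊗ ⋯ ⊗ f_{j,n}`. It is only used for `F` in `algTensor d N n`, for which such
representations exist. -/
def tensorNorm {d N : ℕ} (p : Seminorm ℂ (TestFun d N)) {n : ℕ} (F : TensorTestFun d N n) : ℝ :=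
  sInf {r : ℝ | ∃ (k : ℕ) (c : Fin k → ℂ) (f : Fin k → Fin n → TestFun d N),
    F = ∑ j, c j • tensorProd (f j) ∧ r = ∑ j, ‖c j‖ * ∏ i, p (f j i)}

/-- Continuity of a linear functional with respect to `‖·‖^{⊗ n}`. -/
def ContinuousForTensorNorm {d N n : ℕ} (p : Seminorm ℂ (TestFun d N))
    (T : TensorTestFun d N n →L[ℂ] ℂ) : Prop :=
  ∃ C : ℝ, ∀ F ∈ algTensor d N n, ‖T F‖ ≤ C * tensorNorm p F

/-- `WT` is the sequence of truncated functions of `W`: for `n ≥ 1`,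
`W_n (f_1 ⊗ ⋯ ⊗ f_n) = ∑_I ∏_{{j_1 < ⋯ < j_l} ∈ I} WT_l (f_{j_1} ⊗ ⋯ ⊗ f_{j_l})`, the sum being over
all partitions `I` of the index set into nonempty blocks. The value `WT 0` plays no role. -/
def IsTruncationOf {d N : ℕ} (WT W : ∀ n, TensorTestFun d N n →L[ℂ] ℂ) : Prop :=
  ∀ n, 1 ≤ n → ∀ f : Fin n → TestFun d N,
    W n (tensorProd f) =
      ∑ I : Finpartition (Finset.univ : Finset (Fin n)),
        ∏ b ∈ I.parts, WT b.card (tensorProd fun i => f (b.orderEmbOfFin rfl i))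

/-- A Hilbert seminorm: a continuous seminorm induced by a positive semidefinite Hermitian
sesquilinear form. -/
structure IsHilbertSeminorm {V : Type*} [AddCommGroup V] [Module ℂ V] [TopologicalSpace V]
    (p : Seminorm ℂ V) : Prop where
  continuous : Continuous p
  exists_inner : ∃ c : PreInnerProductSpace.Core ℂ V, ∀ f, p f ^ 2 = (c.inner f f).re

/-- The Hilbert space structure condition. -/
def HilbertSpaceStructureCondition {d N : ℕ} (W : ∀ n, TensorTestFun d N n →L[ℂ] ℂ) : Prop :=
  ∃ p : ∀ n, Seminorm ℂ (TensorTestFun d N n), (∀ n, IsHilbertSeminorm (p n)) ∧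
    ∀ (n m : ℕ) (f : TensorTestFun d N n) (h : TensorTestFun d N m),
      ‖W (n + m) (tensor f h)‖ ≤ p n f * p m h

end Wightman

end

/-!
Expand a test function on `(ℝ^d)^n`, component by component, in the Gabor series obtained from a
lattice partition of unity and the Fourier series of the localized pieces. The atoms are products of
one-particle test functions and grow only polynomially with the lattice and frequency indices, while
the coefficients decay faster than any power, with control by a continuous seminorm. A functional
bounded on product functions is therefore dominated by an absolutely convergent sum of coefficients,
which by Cauchy–Schwarz is at most a weighted `ℓ²` norm of the coefficients, a Hilbert seminorm that
does not depend on the functional. The sum over partitions bounds `W_{n+m}` on product functions,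
and the domination applied in each of its two slots separates `f` from `h`; the constants are
separated by `C_{n+m} ≤ K_n K_m` with `K_n = 1 + ∑_{k ≤ 2n} C_k`.
-/

noncomputable section

namespace Wightman

open Filter Topology FourierTransform MeasureTheory

section Seminorms

variable {E F : Type*} [NormedAddCommGroup E] [NormedSpace ℝ E]
  [NormedAddCommGroup F] [NormedSpace ℝ F]

theorem iteratedFDeriv_eq_tsum_of_summable_seminorm {A : Type*} {g : A → 𝓢(E, F)} {f : 𝓢(E, F)}
    [CompleteSpace F] (hg : ∀ l : ℕ, Summable fun a => SchwartzMap.seminorm ℝ 0 l (g a))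
    (hf : ∀ x, HasSum (fun a => g a x) (f x)) (l : ℕ) (x : E) :
    iteratedFDeriv ℝ l f x = ∑' a, iteratedFDeriv ℝ l (g a) x := by
  have hfun : (f : E → F) = fun x => ∑' a, g a x := funext fun x => (hf x).tsum_eq.symm
  rw [hfun]
  exact iteratedFDeriv_tsum_apply (N := ⊤) (v := fun l a => SchwartzMap.seminorm ℝ 0 l (g a))
    (fun a => (g a).smooth ⊤) (fun l _ => hg l)
    (fun l a x _ => by simpa using (g a).le_seminorm ℝ 0 l x) le_top x

theorem seminorm_sub_sum_le_tsum_compl {A : Type*} {g : A → 𝓢(E, F)} {f : 𝓢(E, F)}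
    [CompleteSpace F] (hg : ∀ k l : ℕ, Summable fun a => SchwartzMap.seminorm ℝ k l (g a))
    (hf : ∀ x, HasSum (fun a => g a x) (f x)) (k l : ℕ) (s : Finset A) :
    SchwartzMap.seminorm ℝ k l (f - ∑ a ∈ s, g a)
      ≤ ∑' a : {a // a ∉ s}, SchwartzMap.seminorm ℝ k l (g a) := by
  refine SchwartzMap.seminorm_le_bound ℝ k l _ (tsum_nonneg fun a => apply_nonneg _ _) fun x => ?_
  have hsum : Summable fun a => iteratedFDeriv ℝ l (g a) x :=
    Summable.of_norm_bounded (hg 0 l) fun a => by simpa using (g a).le_seminorm ℝ 0 l x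
  have hcoe : ((f - ∑ a ∈ s, g a : 𝓢(E, F)) : E → F) = (f : E → F) - fun x => ∑ a ∈ s, g a x := by
    ext x; simp
  have htail : iteratedFDeriv ℝ l (f - ∑ a ∈ s, g a : 𝓢(E, F)) x
      = ∑' a : {a // a ∉ s}, iteratedFDeriv ℝ l (g a) x := by
    rw [hcoe, iteratedFDeriv_sub_apply (f.contDiffAt l)
      (ContDiffAt.sum fun a _ => (g a).contDiffAt l),
      iteratedFDeriv_sum fun a _ => (g a).smooth l, Finset.sum_apply,
      iteratedFDeriv_eq_tsum_of_summable_seminorm (hg 0) hf,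
      ← hsum.sum_add_tsum_subtype_compl s, add_sub_cancel_left]
  calc ‖x‖ ^ k * ‖iteratedFDeriv ℝ l (f - ∑ a ∈ s, g a : 𝓢(E, F)) x‖
      = ‖∑' a : {a // a ∉ s}, ‖x‖ ^ k • iteratedFDeriv ℝ l (g a) x‖ := by
        rw [htail, tsum_const_smul'', norm_smul, norm_pow, norm_norm]
    _ ≤ _ := tsum_of_norm_bounded ((hg k l).subtype _).hasSum fun a => by
        rw [norm_smul, norm_pow, norm_norm]
        exact (g a).le_seminorm ℝ k l x

theorem hasSum_schwartz_of_pointwise {A : Type*} {g : A → 𝓢(E, F)} {f : 𝓢(E, F)} [CompleteSpace F]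
    (hg : ∀ k l : ℕ, Summable fun a => SchwartzMap.seminorm ℝ k l (g a))
    (hf : ∀ x, HasSum (fun a => g a x) (f x)) : HasSum g f := by
  refine ((schwartz_withSeminorms ℝ E F).tendsto_nhds _ _).2 fun ⟨k, l⟩ ε hε => ?_
  have htail := tendsto_tsum_compl_atTop_zero fun a => SchwartzMap.seminorm ℝ k l (g a)
  filter_upwards [htail.eventually (gt_mem_nhds hε)] with s hs
  rw [map_sub_rev]
  exact (seminorm_sub_sum_le_tsum_compl hg hf k l s).trans_lt hs

variable [NormedSpace ℂ F] [SMulCommClass ℝ ℂ F]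

/-- The increasing family of Schwartz seminorms `max_{(k, l) ≤ m} ‖·‖_{k, l}`, used to express a
bound on all seminorms up to a given order by one inequality. -/
def supSeminorm (E F : Type*) [NormedAddCommGroup E] [NormedSpace ℝ E]
    [NormedAddCommGroup F] [NormedSpace ℝ F] [NormedSpace ℂ F] [SMulCommClass ℝ ℂ F] (m : ℕ × ℕ) :
    Seminorm ℂ 𝓢(E, F) :=
  (Finset.Iic m).sup (schwartzSeminormFamily ℂ E F)

theorem continuous_supSeminorm (m : ℕ × ℕ) : Continuous (supSeminorm E F m) :=
  Seminorm.continuous_finsetSup fun i _ => (schwartz_withSeminorms ℂ E F).continuous_seminorm i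

theorem supSeminorm_le_bound {m : ℕ × ℕ} {f : 𝓢(E, F)} {C : ℝ} (hC : 0 ≤ C)
    (h : ∀ k ≤ m.1, ∀ l ≤ m.2, ∀ x, ‖x‖ ^ k * ‖iteratedFDeriv ℝ l f x‖ ≤ C) :
    supSeminorm E F m f ≤ C :=
  Seminorm.finset_sup_apply_le hC fun i hi =>
    have hi := Finset.mem_Iic.1 hi
    SchwartzMap.seminorm_le_bound ℂ i.1 i.2 f hC (h i.1 hi.1 i.2 hi.2)

theorem one_add_pow_mul_le_supSeminorm {k l : ℕ} {m : ℕ × ℕ} (hk : k ≤ m.1) (hl : l ≤ m.2)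
    (f : 𝓢(E, F)) (x : E) :
    (1 + ‖x‖) ^ k * ‖iteratedFDeriv ℝ l f x‖ ≤ 2 ^ m.1 * supSeminorm E F m f :=
  SchwartzMap.one_add_le_sup_seminorm_apply hk hl f x

theorem one_add_pow_mul_norm_apply_le (M : ℕ) (f : 𝓢(E, F)) (x : E) :
    (1 + ‖x‖) ^ M * ‖f x‖ ≤ 2 ^ M * supSeminorm E F (M, 0) f := by
  simpa only [norm_iteratedFDeriv_zero] using
    one_add_pow_mul_le_supSeminorm (m := (M, 0)) le_rfl le_rfl f x

theorem exists_le_smul_supSeminorm {q : Seminorm ℂ 𝓢(E, F)} (hq : Continuous q) :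
    ∃ (m : ℕ × ℕ) (C : NNReal), q ≤ C • supSeminorm E F m := by
  obtain ⟨S, C, -, hS⟩ := Seminorm.bound_of_continuous (schwartz_withSeminorms ℂ E F) q hq
  have hle : S ⊆ Finset.Iic (S.sup id) := fun i hi => Finset.mem_Iic.2 (Finset.le_sup (f := id) hi)
  exact ⟨S.sup id, C, fun f => (hS f).trans <|
    mul_le_mul_of_nonneg_left (Finset.sup_mono (f := schwartzSeminormFamily ℂ E F) hle f) C.2⟩

theorem supSeminorm_compSubConst_le (m : ℕ × ℕ) (y : E) (f : 𝓢(E, F)) :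
    supSeminorm E F m (SchwartzMap.compSubConstCLM ℂ y f)
      ≤ (1 + ‖y‖) ^ m.1 * (2 ^ m.1 * supSeminorm E F m f) := by
  refine supSeminorm_le_bound (by positivity) fun k hk l hl x => ?_
  have hD : iteratedFDeriv ℝ l (SchwartzMap.compSubConstCLM ℂ y f) x
      = iteratedFDeriv ℝ l f (x - y) := iteratedFDeriv_comp_sub l y x
  have hxy : ‖x‖ ≤ (1 + ‖y‖) * (1 + ‖x - y‖) := by
    nlinarith [norm_le_norm_add_norm_sub y x, norm_nonneg y, norm_nonneg (x - y),
      norm_sub_rev x y]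
  calc ‖x‖ ^ k * ‖iteratedFDeriv ℝ l (SchwartzMap.compSubConstCLM ℂ y f) x‖
      ≤ ((1 + ‖y‖) * (1 + ‖x - y‖)) ^ k * ‖iteratedFDeriv ℝ l f (x - y)‖ := by rw [hD]; gcongr
    _ = (1 + ‖y‖) ^ k * ((1 + ‖x - y‖) ^ k * ‖iteratedFDeriv ℝ l f (x - y)‖) := by
        rw [mul_pow, mul_assoc]
    _ ≤ (1 + ‖y‖) ^ m.1 * (2 ^ m.1 * supSeminorm E F m f) :=
        mul_le_mul (pow_le_pow_right₀ (by linarith [norm_nonneg y]) hk)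
          (one_add_pow_mul_le_supSeminorm hk hl f _) (by positivity) (by positivity)

theorem exists_translation_bound {q : Seminorm ℂ 𝓢(E, F)} (hq : Continuous q) :
    ∃ (M : ℕ) (s : Seminorm ℂ 𝓢(E, F)), Continuous s ∧
      ∀ y f, q (SchwartzMap.compSubConstCLM ℂ y f) ≤ (1 + ‖y‖) ^ M * s f := by
  obtain ⟨m, C, hqm⟩ := exists_le_smul_supSeminorm hq
  refine ⟨m.1, (C * 2 ^ m.1) • supSeminorm E F m, (continuous_supSeminorm m).const_smul _,
    fun y f => ?_⟩
  calc q (SchwartzMap.compSubConstCLM ℂ y f)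
      ≤ C * ((1 + ‖y‖) ^ m.1 * (2 ^ m.1 * supSeminorm E F m f)) :=
        (hqm _).trans (mul_le_mul_of_nonneg_left (supSeminorm_compSubConst_le m y f) C.2)
    _ = (1 + ‖y‖) ^ m.1 * ((C * 2 ^ m.1 : NNReal) • supSeminorm E F m) f := by
        rw [smul_apply, NNReal.smul_def, smul_eq_mul]; push_cast; ring

theorem weighted_translate_term_le (θ f : 𝓢(E, ℂ)) (M : ℕ) (m : ℕ × ℕ) (y x : E) {k i j : ℕ}
    (hk : k ≤ m.1) (hi : i ≤ m.2) (hj : j ≤ m.2) :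
    (1 + ‖y‖) ^ M * (‖x‖ ^ k * (‖iteratedFDeriv ℝ i θ (x - y)‖ * ‖iteratedFDeriv ℝ j f x‖))
      ≤ (2 ^ M * supSeminorm E ℂ (M, m.2) θ) *
        (2 ^ (M + m.1) * supSeminorm E ℂ (M + m.1, m.2) f) := by
  have hxy : 1 + ‖y‖ ≤ (1 + ‖x - y‖) * (1 + ‖x‖) := by
    nlinarith [norm_le_norm_add_norm_sub x y, norm_nonneg x, norm_nonneg (x - y),
      norm_sub_rev x y]
  set a := ‖iteratedFDeriv ℝ i θ (x - y)‖
  set b := ‖iteratedFDeriv ℝ j f x‖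
  calc (1 + ‖y‖) ^ M * (‖x‖ ^ k * (a * b))
      ≤ ((1 + ‖x - y‖) * (1 + ‖x‖)) ^ M * ((1 + ‖x‖) ^ k * (a * b)) := by
        gcongr
        linarith [norm_nonneg x]
    _ = ((1 + ‖x - y‖) ^ M * a) * ((1 + ‖x‖) ^ (M + k) * b) := by
        rw [mul_pow, pow_add]; ring
    _ ≤ _ := mul_le_mul (one_add_pow_mul_le_supSeminorm (m := (M, m.2)) le_rfl hi θ _)
        (one_add_pow_mul_le_supSeminorm (m := (M + m.1, m.2)) (Nat.add_le_add_left hk M) hj f x)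
        (by positivity) (by positivity)

theorem norm_iteratedFDeriv_mul_translate_le (θ f : 𝓢(E, ℂ)) (M : ℕ) (m : ℕ × ℕ) (y x : E)
    {k l : ℕ} (hk : k ≤ m.1) (hl : l ≤ m.2) :
    (1 + ‖y‖) ^ M * (‖x‖ ^ k *
        ‖iteratedFDeriv ℝ l (fun x => SchwartzMap.compSubConstCLM ℂ y θ x • f x) x‖)
      ≤ 2 ^ m.2 * ((2 ^ M * supSeminorm E ℂ (M, m.2) θ) *
        (2 ^ (M + m.1) * supSeminorm E ℂ (M + m.1, m.2) f)) := by
  have hD : ∀ i, iteratedFDeriv ℝ i (SchwartzMap.compSubConstCLM ℂ y θ) x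
      = iteratedFDeriv ℝ i θ (x - y) := fun i => iteratedFDeriv_comp_sub i y x
  have hLeibniz := norm_iteratedFDeriv_smul_le (𝕜 := ℝ) (N := ∞)
    ((SchwartzMap.compSubConstCLM ℂ y θ).smooth ⊤) (f.smooth ⊤) x (n := l) (mod_cast le_top)
  simp only [hD, mul_assoc] at hLeibniz
  set S := (2 ^ M * supSeminorm E ℂ (M, m.2) θ) *
    (2 ^ (M + m.1) * supSeminorm E ℂ (M + m.1, m.2) f)
  calc _ ≤ (1 + ‖y‖) ^ M * (‖x‖ ^ k * ∑ i ∈ Finset.range (l + 1), l.choose i *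
        (‖iteratedFDeriv ℝ i θ (x - y)‖ * ‖iteratedFDeriv ℝ (l - i) f x‖)) := by gcongr
    _ ≤ ∑ i ∈ Finset.range (l + 1), (l.choose i : ℝ) * S := by
        rw [Finset.mul_sum, Finset.mul_sum]
        refine Finset.sum_le_sum fun i hi => ?_
        rw [mul_left_comm (‖x‖ ^ k), mul_left_comm]
        exact mul_le_mul_of_nonneg_left (weighted_translate_term_le θ f M m y x hk
          ((Finset.mem_range_succ_iff.1 hi).trans hl) ((Nat.sub_le l i).trans hl))
          (Nat.cast_nonneg _)
    _ = 2 ^ l * S := by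
        rw [← Finset.sum_mul, ← Nat.cast_sum, Nat.sum_range_choose, Nat.cast_pow, Nat.cast_ofNat]
    _ ≤ 2 ^ m.2 * S := by gcongr; norm_num

theorem supSeminorm_mul_translate_le (θ f : 𝓢(E, ℂ)) (M : ℕ) (m : ℕ × ℕ) (y : E) :
    supSeminorm E ℂ m (SchwartzMap.smulLeftCLM ℂ (SchwartzMap.compSubConstCLM ℂ y θ) f)
      ≤ ((1 + ‖y‖) ^ M)⁻¹ * (2 ^ m.2 * ((2 ^ M * supSeminorm E ℂ (M, m.2) θ) *
        (2 ^ (M + m.1) * supSeminorm E ℂ (M + m.1, m.2) f))) := by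
  refine supSeminorm_le_bound (by positivity) fun k hk l hl x => ?_
  rw [le_inv_mul_iff₀ (by positivity),
    SchwartzMap.smulLeftCLM_apply (SchwartzMap.hasTemperateGrowth _) f]
  exact norm_iteratedFDeriv_mul_translate_le θ f M m y x hk hl

theorem exists_mul_translate_bound (θ : 𝓢(E, ℂ)) (M : ℕ) {q : Seminorm ℂ 𝓢(E, ℂ)}
    (hq : Continuous q) :
    ∃ s : Seminorm ℂ 𝓢(E, ℂ), Continuous s ∧ ∀ y f,
      q (SchwartzMap.smulLeftCLM ℂ (SchwartzMap.compSubConstCLM ℂ y θ) f)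
        ≤ ((1 + ‖y‖) ^ M)⁻¹ * s f := by
  obtain ⟨m, C, hqm⟩ := exists_le_smul_supSeminorm hq
  obtain ⟨a, ha⟩ : ∃ a : NNReal, (a : ℝ) = supSeminorm E ℂ (M, m.2) θ :=
    ⟨⟨_, apply_nonneg _ _⟩, rfl⟩
  refine ⟨(C * (2 ^ m.2 * ((2 ^ M * a) * 2 ^ (M + m.1)))) • supSeminorm E ℂ (M + m.1, m.2),
    (continuous_supSeminorm _).const_smul _, fun y f => ?_⟩
  refine ((hqm _).trans
    (mul_le_mul_of_nonneg_left (supSeminorm_mul_translate_le θ f M m y) C.2)).trans_eq ?_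
  rw [smul_apply, NNReal.smul_def, smul_eq_mul, ← ha]
  push_cast
  ring

end Seminorms

section TimeFrequency

variable {V : Type*} [NormedAddCommGroup V] [InnerProductSpace ℝ V] [FiniteDimensional ℝ V]
  [MeasurableSpace V] [BorelSpace V]

/-- The time-frequency shift `x ↦ e^{2πi⟨ξ, x⟩} u (x - y)` of `u`, which produces the Gabor atoms
from a window. It is defined as a translation on the Fourier side, so that its seminorms are
controlled by translation bounds alone; see `timeFreqShift_apply`. -/
def timeFreqShift (y ξ : V) (u : 𝓢(V, ℂ)) : 𝓢(V, ℂ) :=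
  𝓕⁻ (SchwartzMap.compSubConstCLM ℂ ξ (𝓕 (SchwartzMap.compSubConstCLM ℂ y u)))

theorem fourierInv_compSubConst (ξ : V) (v : 𝓢(V, ℂ)) (x : V) :
    𝓕⁻ (SchwartzMap.compSubConstCLM ℂ ξ v) x = Real.fourierChar (inner ℝ ξ x) * 𝓕⁻ v x := by
  rw [SchwartzMap.fourierInv_coe, SchwartzMap.fourierInv_coe, Real.fourierInv_eq,
    Real.fourierInv_eq, ← integral_const_mul,
    ← integral_sub_right_eq_self (fun w => _ * (Real.fourierChar (inner ℝ w x) • v w)) ξ]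
  refine integral_congr_ae (.of_forall fun w => ?_)
  simp only [SchwartzMap.compSubConstCLM_apply, Circle.smul_def, smul_eq_mul, ← mul_assoc,
    ← Circle.coe_mul, ← AddChar.map_add_eq_mul, inner_sub_left, add_sub_cancel]

theorem timeFreqShift_apply (y ξ : V) (u : 𝓢(V, ℂ)) (x : V) :
    timeFreqShift y ξ u x = Real.fourierChar (inner ℝ ξ x) * u (x - y) := by
  rw [timeFreqShift, fourierInv_compSubConst, FourierTransform.fourierInv_fourier_eq]
  rfl

theorem exists_timeFreqShift_bound {q : Seminorm ℂ 𝓢(V, ℂ)} (hq : Continuous q) (u : 𝓢(V, ℂ)) :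
    ∃ (M : ℕ) (C : ℝ), 0 ≤ C ∧
      ∀ y ξ, q (timeFreqShift y ξ u) ≤ C * ((1 + ‖y‖) * (1 + ‖ξ‖)) ^ M := by
  obtain ⟨M₁, s₁, hs₁, h₁⟩ := exists_translation_bound
    (q := q.comp (fourierInvCLM ℂ 𝓢(V, ℂ)).toLinearMap)
    (hq.comp (fourierInvCLM ℂ 𝓢(V, ℂ)).continuous)
  obtain ⟨M₂, s₂, -, h₂⟩ := exists_translation_bound
    (q := s₁.comp (fourierCLM ℂ 𝓢(V, ℂ)).toLinearMap)
    (hs₁.comp (fourierCLM ℂ 𝓢(V, ℂ)).continuous)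
  refine ⟨M₁ + M₂, s₂ u, apply_nonneg _ _, fun y ξ => ?_⟩
  have hy : (1 : ℝ) ≤ 1 + ‖y‖ := by linarith [norm_nonneg y]
  have hξ : (1 : ℝ) ≤ 1 + ‖ξ‖ := by linarith [norm_nonneg ξ]
  calc q (timeFreqShift y ξ u)
      ≤ (1 + ‖ξ‖) ^ M₁ * s₁ (𝓕 (SchwartzMap.compSubConstCLM ℂ y u)) := h₁ ξ _
    _ ≤ (1 + ‖ξ‖) ^ M₁ * ((1 + ‖y‖) ^ M₂ * s₂ u) :=
        mul_le_mul_of_nonneg_left (h₂ y u) (by positivity)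
    _ ≤ (1 + ‖ξ‖) ^ (M₁ + M₂) * ((1 + ‖y‖) ^ (M₁ + M₂) * s₂ u) := by
        gcongr
        exacts [M₁.le_add_right M₂, M₂.le_add_left M₁]
    _ = s₂ u * ((1 + ‖y‖) * (1 + ‖ξ‖)) ^ (M₁ + M₂) := by rw [mul_pow]; ring

/-- The short-time Fourier transform `f ↦ ∫ θ(x - y) f(x) e^{-2πi⟨ξ, x⟩} dx` with window `θ`, which
yields the coefficients of the Gabor expansion. -/
def shortTimeFourier (θ : 𝓢(V, ℂ)) (y ξ : V) : 𝓢(V, ℂ) →ₗ[ℂ] ℂ where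
  toFun f := 𝓕 (SchwartzMap.smulLeftCLM ℂ (SchwartzMap.compSubConstCLM ℂ y θ) f) ξ
  map_add' f g := by rw [map_add, FourierTransform.fourier_add]; rfl
  map_smul' c f := by rw [map_smul, FourierTransform.fourier_smul]; rfl

theorem exists_shortTimeFourier_bound (θ : 𝓢(V, ℂ)) (M : ℕ) :
    ∃ s : Seminorm ℂ 𝓢(V, ℂ), Continuous s ∧ ∀ y ξ f,
      ‖shortTimeFourier θ y ξ f‖ ≤ (((1 + ‖y‖) * (1 + ‖ξ‖)) ^ M)⁻¹ * s f := by
  obtain ⟨s, hs, h⟩ := exists_mul_translate_bound θ M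
    (q := (supSeminorm V ℂ (M, 0)).comp (fourierCLM ℂ 𝓢(V, ℂ)).toLinearMap)
    ((continuous_supSeminorm _).comp (fourierCLM ℂ 𝓢(V, ℂ)).continuous)
  refine ⟨(2 ^ M : NNReal) • s, hs.const_smul _, fun y ξ f => ?_⟩
  have hξ : (1 + ‖ξ‖) ^ M * ‖shortTimeFourier θ y ξ f‖
      ≤ 2 ^ M * supSeminorm V ℂ (M, 0)
        (𝓕 (SchwartzMap.smulLeftCLM ℂ (SchwartzMap.compSubConstCLM ℂ y θ) f)) :=
    one_add_pow_mul_norm_apply_le M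
      (𝓕 (SchwartzMap.smulLeftCLM ℂ (SchwartzMap.compSubConstCLM ℂ y θ) f)) ξ
  rw [mul_pow, mul_inv, smul_apply, NNReal.smul_def, smul_eq_mul,
    mul_comm (((1 + ‖y‖) ^ M)⁻¹), mul_assoc, le_inv_mul_iff₀ (by positivity), mul_left_comm]
  exact hξ.trans (mul_le_mul_of_nonneg_left (h y f) (by positivity))

end TimeFrequency

section Torus

variable {κ : Type*}

/-- The function on the torus that represents a function on the cube of side `1` centred at `a`.
It depends only on the values on the half-open cube, so it extends `h` from the closed cube
when `h` vanishes on the boundary. -/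
def torusLift (a : κ → ℝ) (h : (κ → ℝ) → ℂ) (t : UnitAddTorus κ) : ℂ :=
  h fun i => (AddCircle.equivIoc 1 (a i - 1 / 2) (t i) : ℝ)

theorem torusLift_coe {a : κ → ℝ} {h : (κ → ℝ) → ℂ}
    (h0 : ∀ z, (∃ i, 1 / 2 ≤ |z i - a i|) → h z = 0) {z : κ → ℝ}
    (hz : ∀ i, |z i - a i| ≤ 1 / 2) : torusLift a h (fun i => (z i : UnitAddCircle)) = h z := by
  by_cases hleft : ∃ i, z i = a i - 1 / 2
  · obtain ⟨i, hi⟩ := hleft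
    have hwrap : ((z i : ℝ) : UnitAddCircle) = ((a i + 1 / 2 : ℝ) : UnitAddCircle) := by
      rw [← AddCircle.coe_add_period 1 (z i), hi]; ring_nf
    rw [h0 z ⟨i, by rw [hi, sub_sub_cancel_left]; norm_num⟩]
    refine h0 _ ⟨i, ?_⟩
    simp only [hwrap]
    rw [AddCircle.equivIoc_coe_eq ⟨by linarith, by linarith⟩]
    simp
  · push Not at hleft
    refine congrArg h (funext fun i => ?_)
    have hi := abs_le.1 (hz i)
    rw [AddCircle.equivIoc_coe_eq ⟨lt_of_le_of_ne (by linarith) (hleft i).symm, by linarith⟩]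

theorem continuous_torusLift {a : κ → ℝ} {h : (κ → ℝ) → ℂ} (hc : Continuous h)
    (h0 : ∀ z, (∃ i, 1 / 2 ≤ |z i - a i|) → h z = 0) : Continuous (torusLift a h) := by
  let cube : Set (κ → ℝ) := Set.univ.pi fun i => Set.Icc (a i - 1 / 2) (a i + 1 / 2)
  let proj : cube → UnitAddTorus κ := fun z i => (z.1 i : UnitAddCircle)
  have : CompactSpace cube :=
    isCompact_iff_compactSpace.1 (isCompact_univ_pi fun i => isCompact_Icc)
  have hproj : Continuous proj := by
    exact continuous_pi fun i =>
      (AddCircle.continuous_mk' 1).comp ((continuous_apply i).comp continuous_subtype_val)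
  have hsurj : Function.Surjective proj := fun t => by
    refine ⟨⟨fun i => (AddCircle.equivIoc 1 (a i - 1 / 2) (t i) : ℝ), fun i _ => ?_⟩,
      funext fun i => (AddCircle.equivIoc 1 (a i - 1 / 2)).symm_apply_apply (t i)⟩
    have hi := (AddCircle.equivIoc 1 (a i - 1 / 2) (t i)).2
    exact ⟨hi.1.le, by linarith [hi.2]⟩
  have hlift : torusLift a h ∘ proj = fun z => h z.1 := funext fun z =>
    torusLift_coe h0 fun i => by
      have hi := z.2 i trivial
      exact abs_le.2 ⟨by linarith [hi.1], by linarith [hi.2]⟩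
  rw [(hproj.isClosedMap.isQuotientMap hproj hsurj).continuous_iff, hlift]
  exact hc.comp continuous_subtype_val

variable [Fintype κ]

theorem mFourier_coe (j : κ → ℤ) (z : κ → ℝ) :
    UnitAddTorus.mFourier j (fun i => (z i : UnitAddCircle))
      = Real.fourierChar (∑ i, (j i : ℝ) * z i) := by
  simp only [UnitAddTorus.mFourier, ContinuousMap.coe_mk, fourier_coe_apply, Real.fourierChar_apply]
  rw [← Complex.exp_sum]
  congr 1
  push_cast
  rw [Finset.mul_sum, Finset.sum_mul]
  exact Finset.sum_congr rfl fun i _ => by ring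

theorem mFourierCoeff_torusLift {a : κ → ℝ} {h : (κ → ℝ) → ℂ}
    (h0 : ∀ z, (∃ i, 1 / 2 ≤ |z i - a i|) → h z = 0) (j : κ → ℤ) :
    UnitAddTorus.mFourierCoeff (torusLift a h) j
      = ∫ z : κ → ℝ, (Real.fourierChar (-∑ i, (j i : ℝ) * z i) : ℂ) * h z := by
  have hcube : ∀ {z : κ → ℝ}, (∀ i, z i ∈ Set.Ioc (a i - 1 / 2) (a i - 1 / 2 + 1)) →
      ∀ i, |z i - a i| ≤ 1 / 2 := fun hz i =>
    abs_le.2 ⟨by linarith [(hz i).1], by linarith [(hz i).2]⟩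
  rw [UnitAddTorus.mFourierCoeff_eq_integral _ _ fun i => a i - 1 / 2]
  refine Eq.trans (setIntegral_congr_fun (MeasurableSet.univ_pi' fun i => measurableSet_Ioc)
    fun z hz => ?_) (setIntegral_eq_integral_of_forall_compl_eq_zero fun z hz => ?_)
  · simp only [mFourier_coe, smul_eq_mul, torusLift_coe h0 (hcube hz)]
    simp
  · obtain ⟨i, hi⟩ := not_forall.1 hz
    rw [h0 z ⟨i, ?_⟩, mul_zero]
    by_contra! hlt
    exact hi ⟨by linarith [(abs_lt.1 hlt).1], by linarith [(abs_lt.1 hlt).2]⟩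

theorem hasSum_fourier_of_eq_zero_off_cube {a : κ → ℝ} {h : (κ → ℝ) → ℂ} (hc : Continuous h)
    (h0 : ∀ z, (∃ i, 1 / 2 ≤ |z i - a i|) → h z = 0)
    (hs : Summable fun j : κ → ℤ => ∫ z : κ → ℝ,
        (Real.fourierChar (-∑ i, (j i : ℝ) * z i) : ℂ) * h z)
    {x : κ → ℝ} (hx : ∀ i, |x i - a i| ≤ 1 / 2) :
    HasSum (fun j : κ → ℤ => (∫ z : κ → ℝ, (Real.fourierChar (-∑ i, (j i : ℝ) * z i) : ℂ) * h z) *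
      Real.fourierChar (∑ i, (j i : ℝ) * x i)) (h x) := by
  let G : C(UnitAddTorus κ, ℂ) := ⟨torusLift a h, continuous_torusLift hc h0⟩
  have hcoeff : ∀ j, UnitAddTorus.mFourierCoeff G j = _ := mFourierCoeff_torusLift h0
  have hsum := UnitAddTorus.hasSum_mFourier_series_apply_of_summable (f := G)
    (by simpa only [funext hcoeff] using hs) fun i => (x i : UnitAddCircle)
  have hGx : G (fun i => (x i : UnitAddCircle)) = h x := torusLift_coe h0 hx
  simpa only [hGx, hcoeff, mFourier_coe, smul_eq_mul] using hsum

end Torus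

section Lattice

variable {κ : Type*} [Fintype κ] {V : Type*} [NormedAddCommGroup V] [InnerProductSpace ℝ V]

/-- The lattice point with integer coordinates `k` in the orthonormal basis `b`; dilates of this
lattice are the positions and the frequencies of the Gabor frame. -/
def latticePoint (b : OrthonormalBasis κ ℝ V) (k : κ → ℤ) : V :=
  ∑ i, k i • b i

theorem repr_latticePoint (b : OrthonormalBasis κ ℝ V) (k : κ → ℤ) (i : κ) :
    b.repr (latticePoint b k) i = k i := by
  classical
  simp [latticePoint, ← Int.cast_smul_eq_zsmul ℝ, Pi.single_apply]

theorem inner_eq_sum_repr (b : OrthonormalBasis κ ℝ V) (x y : V) :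
    inner ℝ x y = ∑ i, b.repr x i * b.repr y i := by
  rw [← b.repr.inner_map_map, PiLp.inner_apply]
  exact Finset.sum_congr rfl fun i _ => by simp [mul_comm]

theorem summable_latticePoint (b : OrthonormalBasis κ ℝ V) {c : ℝ} (hc : c ≠ 0) :
    Summable fun k => ((1 + ‖c • latticePoint b k‖) ^ (Fintype.card κ + 1))⁻¹ := by
  have := b.toBasis.finiteDimensional_of_finite
  let B := b.toBasis.restrictScalars ℤ
  have hB : ∀ k, ((B.equivFun.symm k : Submodule.span ℤ (Set.range b.toBasis)) : V)
      = latticePoint b k := fun k => by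
    rw [Module.Basis.equivFun_symm_apply, Submodule.coe_sum]
    refine Finset.sum_congr rfl fun i _ => ?_
    rw [Submodule.coe_smul, Module.Basis.restrictScalars_apply, b.coe_toBasis]
  have hrank : Module.finrank ℤ (Submodule.span ℤ (Set.range b.toBasis)) < Fintype.card κ + 1 := by
    rw [Module.finrank_eq_card_basis B]
    exact Nat.lt_succ_self _
  have hsum := (B.equivFun.symm.toEquiv.summable_iff.2
    (ZLattice.summable_norm_pow_inv _ _ hrank)).mul_left (‖c‖⁻¹ ^ (Fintype.card κ + 1))
  refine .of_norm_bounded_eventually hsum ?_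
  filter_upwards [(Set.finite_singleton (0 : κ → ℤ)).compl_mem_cofinite] with k hk
  have hpos : 0 < ‖latticePoint b k‖ := by
    rwa [norm_pos_iff, ← hB, ne_eq, Submodule.coe_eq_zero, LinearEquiv.map_eq_zero_iff]
  simp only [Function.comp_apply, LinearEquiv.coe_toEquiv, Submodule.coe_norm, hB]
  rw [norm_inv, norm_pow, ← mul_pow, ← mul_inv, ← norm_smul, inv_pow,
    Real.norm_of_nonneg (by positivity)]
  have : 0 < ‖c • latticePoint b k‖ := by
    rw [norm_smul]
    exact mul_pos (norm_pos_iff.2 hc) hpos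
  gcongr
  linarith

theorem summable_apply_latticePoint (b : OrthonormalBasis κ ℝ V) (f : 𝓢(V, ℂ)) :
    Summable fun k => f (latticePoint b k) := by
  have hsum := summable_latticePoint b one_ne_zero
  simp only [one_smul] at hsum
  refine .of_norm_bounded (hsum.mul_left
    (2 ^ (Fintype.card κ + 1) * supSeminorm V ℂ (Fintype.card κ + 1, 0) f)) fun k => ?_
  rw [← div_eq_mul_inv, le_div_iff₀' (by positivity)]
  exact one_add_pow_mul_norm_apply_le _ f (latticePoint b k)

end Lattice

section Window

/-- The one-dimensional profile of the Gabor window: a smooth bump on `[-1/2, 1/2]` such that the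
squares of its translates by `ℤ/2` form a partition of unity. At every point only one sine and one
cosine, with the same argument, contribute to the sum of squares. -/
def squarePartitionBump (t : ℝ) : ℝ :=
  Real.sin (Real.pi / 2 * Real.smoothTransition (2 * t + 1)) *
    Real.cos (Real.pi / 2 * Real.smoothTransition (2 * t))

theorem contDiff_squarePartitionBump : ContDiff ℝ ∞ squarePartitionBump :=
  (Real.contDiff_sin.comp
      (contDiff_const.mul (Real.smoothTransition.contDiff.comp (by fun_prop)))).mul
    (Real.contDiff_cos.comp
      (contDiff_const.mul (Real.smoothTransition.contDiff.comp (by fun_prop))))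

theorem squarePartitionBump_eq_zero {t : ℝ} (ht : 1 / 2 ≤ |t|) : squarePartitionBump t = 0 := by
  rcases le_abs.1 ht with h | h
  · rw [squarePartitionBump, Real.smoothTransition.one_of_one_le (x := 2 * t) (by linarith),
      mul_one, Real.cos_pi_div_two, mul_zero]
  · rw [squarePartitionBump, Real.smoothTransition.zero_of_nonpos (x := 2 * t + 1) (by linarith),
      mul_zero, Real.sin_zero, zero_mul]

theorem squarePartitionBump_sq_add_sq {t : ℝ} (h0 : 0 ≤ t) (h1 : t ≤ 1 / 2) :
    squarePartitionBump t ^ 2 + squarePartitionBump (t - 1 / 2) ^ 2 = 1 := by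
  rw [squarePartitionBump, squarePartitionBump,
    Real.smoothTransition.one_of_one_le (x := 2 * t + 1) (by linarith),
    Real.smoothTransition.zero_of_nonpos (x := 2 * (t - 1 / 2)) (by linarith),
    mul_one, Real.sin_pi_div_two, mul_zero, Real.cos_zero, one_mul, mul_one,
    show 2 * (t - 1 / 2) + 1 = 2 * t by ring, Real.cos_sq_add_sin_sq]

theorem exists_finset_sum_squarePartitionBump_sq (t : ℝ) : ∃ S : Finset ℤ,
    (∀ k ∉ S, squarePartitionBump (t - k / 2) = 0) ∧
      ∑ k ∈ S, squarePartitionBump (t - k / 2) ^ 2 = 1 := by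
  have h1 := Int.floor_le (2 * t)
  have h2 := Int.lt_floor_add_one (2 * t)
  refine ⟨{⌊2 * t⌋, ⌊2 * t⌋ + 1}, fun k hk => squarePartitionBump_eq_zero (le_abs.2 ?_), ?_⟩
  · simp only [Finset.mem_insert, Finset.mem_singleton, not_or] at hk
    rcases lt_or_gt_of_ne hk.1 with h | h
    · have : (k : ℝ) + 1 ≤ ⌊2 * t⌋ := by exact_mod_cast h
      exact .inl (by linarith)
    · have : (⌊2 * t⌋ : ℝ) + 2 ≤ k := by exact_mod_cast (by omega : ⌊2 * t⌋ + 2 ≤ k)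
      exact .inr (by linarith)
  · have hshift : t - ((⌊2 * t⌋ + 1 : ℤ) : ℝ) / 2 = t - ⌊2 * t⌋ / 2 - 1 / 2 := by
      push_cast; ring
    rw [Finset.sum_pair (by omega), hshift]
    exact squarePartitionBump_sq_add_sq (by linarith) (by linarith)

variable {κ : Type*} [Fintype κ] {V : Type*} [NormedAddCommGroup V] [InnerProductSpace ℝ V]

theorem prod_squarePartitionBump_eq_zero (b : OrthonormalBasis κ ℝ V) {x : V}
    (hx : ∃ i, 1 / 2 ≤ |b.repr x i|) : ∏ i, (squarePartitionBump (b.repr x i) : ℂ) = 0 := by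
  obtain ⟨i, hi⟩ := hx
  exact Finset.prod_eq_zero (Finset.mem_univ i)
    (by rw [squarePartitionBump_eq_zero hi, Complex.ofReal_zero])

theorem hasCompactSupport_prod_squarePartitionBump (b : OrthonormalBasis κ ℝ V) :
    HasCompactSupport fun x => ∏ i, (squarePartitionBump (b.repr x i) : ℂ) := by
  have hcont : Continuous fun z : κ → ℝ => b.repr.symm (WithLp.toLp 2 z) :=
    b.repr.symm.continuous.comp (PiLp.continuous_toLp 2 _)
  refine .intro ((isCompact_univ_pi fun _ => isCompact_Icc (a := -(1 / 2 : ℝ))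
    (b := 1 / 2)).image hcont) fun x hx => prod_squarePartitionBump_eq_zero b ?_
  by_contra! hlt
  exact hx ⟨fun i => b.repr x i, fun i _ => abs_le.1 (hlt i).le, by simp⟩

/-- The window of the Gabor expansion, used for analysis and for synthesis. -/
def gaborWindow (b : OrthonormalBasis κ ℝ V) : 𝓢(V, ℂ) :=
  (hasCompactSupport_prod_squarePartitionBump b).toSchwartzMap
    (contDiff_prod fun i _ => Complex.ofRealCLM.contDiff.comp (contDiff_squarePartitionBump.comp
      ((PiLp.proj 2 (fun _ : κ => ℝ) i : EuclideanSpace ℝ κ →L[ℝ] ℝ).contDiff.comp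
        b.repr.toContinuousLinearEquiv.contDiff)))

theorem gaborWindow_apply (b : OrthonormalBasis κ ℝ V) (x : V) :
    gaborWindow b x = ∏ i, (squarePartitionBump (b.repr x i) : ℂ) := rfl

theorem gaborWindow_eq_zero (b : OrthonormalBasis κ ℝ V) {x : V}
    (hx : ∃ i, 1 / 2 ≤ |b.repr x i|) : gaborWindow b x = 0 :=
  prod_squarePartitionBump_eq_zero b hx

theorem repr_sub_half_latticePoint (b : OrthonormalBasis κ ℝ V) (x : V) (k : κ → ℤ) (i : κ) :
    b.repr (x - (1 / 2 : ℝ) • latticePoint b k) i = b.repr x i - k i / 2 := by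
  rw [map_sub, map_smul, PiLp.sub_apply, PiLp.smul_apply, repr_latticePoint, smul_eq_mul]
  ring

theorem hasSum_gaborWindow_sq (b : OrthonormalBasis κ ℝ V) (x : V) :
    HasSum (fun k => gaborWindow b (x - (1 / 2 : ℝ) • latticePoint b k) ^ 2) 1 := by
  classical
  choose S hS0 hS1 using fun i => exists_finset_sum_squarePartitionBump_sq (b.repr x i)
  have hval : ∀ k, gaborWindow b (x - (1 / 2 : ℝ) • latticePoint b k) ^ 2
      = ∏ i, (squarePartitionBump (b.repr x i - k i / 2) ^ 2 : ℂ) := fun k => by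
    simp only [gaborWindow_apply, repr_sub_half_latticePoint, Finset.prod_pow]
  have hS : ∑ k ∈ Fintype.piFinset S, gaborWindow b (x - (1 / 2 : ℝ) • latticePoint b k) ^ 2
      = 1 := by
    simp only [hval]
    rw [← Finset.prod_univ_sum S fun i m => (squarePartitionBump (b.repr x i - m / 2) ^ 2 : ℂ)]
    exact Finset.prod_eq_one fun i _ => by exact_mod_cast hS1 i
  rw [← hS]
  refine hasSum_sum_of_ne_finset_zero fun k hk => ?_
  obtain ⟨i, hi⟩ := not_forall.1 fun h => hk (Fintype.mem_piFinset.2 h)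
  rw [hval]
  exact Finset.prod_eq_zero (Finset.mem_univ i) (by simp [hS0 i _ hi])

end Window

section Gabor

variable {κ : Type*} [Fintype κ] {V : Type*} [NormedAddCommGroup V] [InnerProductSpace ℝ V]

/-- The weight `(1 + |y|) (1 + |ξ|)` of a point `(y, ξ)` of the time-frequency lattice; Gabor
coefficients decay faster than all its powers and Gabor atoms grow at most like a power. -/
def gaborWeight (b : OrthonormalBasis κ ℝ V) (a : (κ → ℤ) × (κ → ℤ)) : ℝ :=
  (1 + ‖(1 / 2 : ℝ) • latticePoint b a.1‖) * (1 + ‖latticePoint b a.2‖)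

theorem one_le_gaborWeight (b : OrthonormalBasis κ ℝ V) (a : (κ → ℤ) × (κ → ℤ)) :
    1 ≤ gaborWeight b a :=
  one_le_mul_of_one_le_of_one_le
    (by linarith [norm_nonneg ((1 / 2 : ℝ) • latticePoint b a.1)])
    (by linarith [norm_nonneg (latticePoint b a.2)])

theorem gaborWeight_pos (b : OrthonormalBasis κ ℝ V) (a : (κ → ℤ) × (κ → ℤ)) :
    0 < gaborWeight b a :=
  zero_lt_one.trans_le (one_le_gaborWeight b a)

theorem summable_gaborWeight (b : OrthonormalBasis κ ℝ V) :
    Summable fun a => (gaborWeight b a ^ (Fintype.card κ + 1))⁻¹ := by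
  have h := (summable_latticePoint b (c := 1 / 2) (by norm_num)).mul_of_nonneg
    (summable_latticePoint b one_ne_zero) (fun k => by positivity) (fun k => by positivity)
  refine h.congr fun a => ?_
  rw [gaborWeight, mul_pow, mul_inv, one_smul]

variable [FiniteDimensional ℝ V] [MeasurableSpace V] [BorelSpace V]

/-- The coefficients of the Gabor expansion, indexed by positions in `ℤ^κ / 2` and frequencies
in `ℤ^κ`. -/
def gaborCoeff (b : OrthonormalBasis κ ℝ V) (a : (κ → ℤ) × (κ → ℤ)) : 𝓢(V, ℂ) →ₗ[ℂ] ℂ :=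
  shortTimeFourier (gaborWindow b) ((1 / 2 : ℝ) • latticePoint b a.1) (latticePoint b a.2)

/-- The atoms of the Gabor expansion, indexed by positions in `ℤ^κ / 2` and frequencies
in `ℤ^κ`. -/
def gaborAtom (b : OrthonormalBasis κ ℝ V) (a : (κ → ℤ) × (κ → ℤ)) : 𝓢(V, ℂ) :=
  timeFreqShift ((1 / 2 : ℝ) • latticePoint b a.1) (latticePoint b a.2) (gaborWindow b)

theorem gaborAtom_apply (b : OrthonormalBasis κ ℝ V) (a : (κ → ℤ) × (κ → ℤ)) (x : V) :
    gaborAtom b a x = Real.fourierChar (∑ i, (a.2 i : ℝ) * b.repr x i) *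
      gaborWindow b (x - (1 / 2 : ℝ) • latticePoint b a.1) := by
  simp only [gaborAtom, timeFreqShift_apply, inner_eq_sum_repr b, repr_latticePoint]

theorem gaborAtom_apply_eq_prod (b : OrthonormalBasis κ ℝ V) (a : (κ → ℤ) × (κ → ℤ)) (x : V) :
    gaborAtom b a x = ∏ i, ((Real.fourierChar (a.2 i * b.repr x i) : ℂ) *
      squarePartitionBump (b.repr x i - a.1 i / 2)) := by
  rw [gaborAtom_apply, gaborWindow_apply, Finset.prod_mul_distrib]
  simp only [Real.fourierChar_apply, ← Complex.exp_sum, repr_sub_half_latticePoint,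
    Finset.mul_sum, Complex.ofReal_sum, Finset.sum_mul]

theorem exists_gaborCoeff_bound (b : OrthonormalBasis κ ℝ V) (M : ℕ) :
    ∃ s : Seminorm ℂ 𝓢(V, ℂ), Continuous s ∧ ∀ a f,
      ‖gaborCoeff b a f‖ ≤ (gaborWeight b a ^ M)⁻¹ * s f := by
  obtain ⟨s, hs, h⟩ := exists_shortTimeFourier_bound (gaborWindow b) M
  exact ⟨s, hs, fun a => h _ _⟩

theorem exists_gaborAtom_bound (b : OrthonormalBasis κ ℝ V) {q : Seminorm ℂ 𝓢(V, ℂ)}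
    (hq : Continuous q) :
    ∃ (M : ℕ) (C : ℝ), 0 ≤ C ∧ ∀ a, q (gaborAtom b a) ≤ C * gaborWeight b a ^ M := by
  obtain ⟨M, C, hC, h⟩ := exists_timeFreqShift_bound hq (gaborWindow b)
  exact ⟨M, C, hC, fun a => h _ _⟩

theorem summable_gabor_seminorm (b : OrthonormalBasis κ ℝ V) (f : 𝓢(V, ℂ))
    {q : Seminorm ℂ 𝓢(V, ℂ)} (hq : Continuous q) :
    Summable fun a => q (gaborCoeff b a f • gaborAtom b a) := by
  obtain ⟨M, C, -, hatom⟩ := exists_gaborAtom_bound b hq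
  obtain ⟨s, -, hcoeff⟩ := exists_gaborCoeff_bound b (Fintype.card κ + 1 + M)
  refine .of_nonneg_of_le (fun a => apply_nonneg _ _) (fun a => ?_)
    ((summable_gaborWeight b).mul_left (s f * C))
  have hw := gaborWeight_pos b a
  calc q (gaborCoeff b a f • gaborAtom b a)
      ≤ ((gaborWeight b a ^ (Fintype.card κ + 1 + M))⁻¹ * s f) * (C * gaborWeight b a ^ M) := by
        rw [map_smul_eq_mul]
        gcongr
        exacts [hcoeff a f, hatom a]
    _ = s f * C * (gaborWeight b a ^ (Fintype.card κ + 1))⁻¹ := by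
        rw [pow_add]
        field_simp

theorem fourier_latticePoint (b : OrthonormalBasis κ ℝ V) (f : 𝓢(V, ℂ)) (j : κ → ℤ) :
    𝓕 f (latticePoint b j) = ∫ z : κ → ℝ,
      (Real.fourierChar (-∑ i, (j i : ℝ) * z i) : ℂ) * f (b.repr.symm (WithLp.toLp 2 z)) := by
  have hmp : MeasurePreserving (fun z : κ → ℝ => b.repr.symm (WithLp.toLp 2 z)) :=
    b.measurePreserving_repr_symm.comp (PiLp.volume_preserving_toLp κ)
  have hemb : MeasurableEmbedding (fun z : κ → ℝ => b.repr.symm (WithLp.toLp 2 z)) :=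
    b.repr.symm.toHomeomorph.measurableEmbedding.comp
      (MeasurableEquiv.toLp 2 (κ → ℝ)).measurableEmbedding
  rw [SchwartzMap.fourier_coe, Real.fourier_eq, ← hmp.integral_comp hemb]
  refine integral_congr_ae (.of_forall fun z => ?_)
  simp [Circle.smul_def, inner_eq_sum_repr b, repr_latticePoint, mul_comm]

theorem hasSum_fourier_latticePoint (b : OrthonormalBasis κ ℝ V) {g : 𝓢(V, ℂ)} {y x : V}
    (hg : ∀ v, (∃ i, 1 / 2 ≤ |b.repr (v - y) i|) → g v = 0)
    (hx : ∀ i, |b.repr (x - y) i| ≤ 1 / 2) :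
    HasSum (fun j => 𝓕 g (latticePoint b j) *
      Real.fourierChar (∑ i, (j i : ℝ) * b.repr x i)) (g x) := by
  have h := hasSum_fourier_of_eq_zero_off_cube (a := fun i => b.repr y i)
    (h := fun z => g (b.repr.symm (WithLp.toLp 2 z))) (x := fun i => b.repr x i)
    (g.continuous.comp (b.repr.symm.continuous.comp (PiLp.continuous_toLp 2 _)))
    (fun z hz => hg _ (by simpa using hz))
    (by simpa only [← fourier_latticePoint] using summable_apply_latticePoint b (𝓕 g))
    (fun i => by simpa using hx i)
  simpa [← fourier_latticePoint] using h

theorem hasSum_gabor_frequency (b : OrthonormalBasis κ ℝ V) (f : 𝓢(V, ℂ)) (k : κ → ℤ) (x : V) :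
    HasSum (fun j => gaborCoeff b (k, j) f * gaborAtom b (k, j) x)
      (gaborWindow b (x - (1 / 2 : ℝ) • latticePoint b k) ^ 2 * f x) := by
  set y := (1 / 2 : ℝ) • latticePoint b k with hy
  let g : 𝓢(V, ℂ) := SchwartzMap.smulLeftCLM ℂ (SchwartzMap.compSubConstCLM ℂ y (gaborWindow b)) f
  have hg : ∀ v, g v = gaborWindow b (v - y) * f v := fun v => by
    simp only [g, SchwartzMap.smulLeftCLM_apply_apply (SchwartzMap.hasTemperateGrowth _),
      SchwartzMap.compSubConstCLM_apply, smul_eq_mul]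
  by_cases hx : ∃ i, 1 / 2 ≤ |b.repr (x - y) i|
  · simp only [gaborAtom_apply, ← hy, gaborWindow_eq_zero b hx, mul_zero, zero_pow two_ne_zero,
      zero_mul, hasSum_zero]
  push Not at hx
  have hsum := (hasSum_fourier_latticePoint b
    (fun v hv => by rw [hg, gaborWindow_eq_zero b hv, zero_mul]) fun i => (hx i).le).mul_right
      (gaborWindow b (x - y))
  rw [hg, mul_right_comm, ← sq] at hsum
  refine hsum.congr_fun fun j => ?_
  rw [gaborAtom_apply, ← mul_assoc]
  rfl

theorem hasSum_gabor (b : OrthonormalBasis κ ℝ V) (f : 𝓢(V, ℂ)) :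
    HasSum (fun a => gaborCoeff b a f • gaborAtom b a) f := by
  have hsem : ∀ k l, Summable fun a =>
      SchwartzMap.seminorm ℂ k l (gaborCoeff b a f • gaborAtom b a) := fun k l =>
    summable_gabor_seminorm b f ((schwartz_withSeminorms ℂ V ℂ).continuous_seminorm (k, l))
  refine hasSum_schwartz_of_pointwise hsem fun x => ?_
  have hsum : Summable fun a => (gaborCoeff b a f • gaborAtom b a) x :=
    .of_norm_bounded (hsem 0 0) fun a => SchwartzMap.norm_le_seminorm ℂ _ x
  have hfiber := hsum.hasSum.prod_fiberwise fun k => hasSum_gabor_frequency b f k x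
  have hwindow := (hasSum_gaborWindow_sq b x).mul_right (f x)
  rw [one_mul] at hwindow
  exact hfiber.unique hwindow ▸ hsum.hasSum

end Gabor

section Components

variable {E : Type*} [NormedAddCommGroup E] [NormedSpace ℝ E] {ι : Type*} [Fintype ι]

/-- The component `f_α` of a vector-valued Schwartz function, to which the scalar Gabor expansion
applies. -/
def component (α : ι) : 𝓢(E, EuclideanSpace ℂ ι) →L[ℂ] 𝓢(E, ℂ) :=
  SchwartzMap.postcompCLM (EuclideanSpace.proj α)

theorem component_apply (α : ι) (f : 𝓢(E, EuclideanSpace ℂ ι)) (x : E) :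
    component α f x = f x α := rfl

variable [DecidableEq ι]

/-- The vector-valued Schwartz function `g e_α` whose only nonzero component is `g`; it rebuilds a
function from its components. -/
def ofComponent (α : ι) : 𝓢(E, ℂ) →L[ℂ] 𝓢(E, EuclideanSpace ℂ ι) :=
  SchwartzMap.postcompCLM (ContinuousLinearMap.toSpanSingleton ℂ (EuclideanSpace.single α (1 : ℂ)))

theorem ofComponent_apply (α β : ι) (g : 𝓢(E, ℂ)) (x : E) :
    ofComponent α g x β = if β = α then g x else 0 := by
  simp [ofComponent]

theorem sum_ofComponent_component (f : 𝓢(E, EuclideanSpace ℂ ι)) :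
    ∑ α, ofComponent α (component α f) = f := by
  ext x β
  simp [ofComponent_apply, component_apply, sum_apply]

end Components

section TensorExpansion

theorem hasSum_prod_of_fintype {ι A X : Type*} [Fintype ι] [AddCommMonoid X]
    [TopologicalSpace X] [ContinuousAdd X] {g : ι × A → X} {x : ι → X}
    (h : ∀ α, HasSum (fun a => g (α, a)) (x α)) : HasSum g (∑ α, x α) := by
  classical
  have hslice : ∀ α ∈ Finset.univ, HasSum (fun z : ι × A => if z.1 = α then g z else 0) (x α) := by
    intro α _
    rw [← (Prod.mk_right_injective α).hasSum_iff]
    · simpa [Function.comp_def] using h α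
    · rintro ⟨β, a⟩ hz
      exact if_neg fun e => hz ⟨a, congrArg (·, a) e.symm⟩
  simpa using hasSum_sum hslice

variable {d N n : ℕ}

/-- The standard orthonormal basis of the configuration space; its Gabor atoms are products of
Gabor atoms in the single particle positions. -/
def configBasis (d n : ℕ) : OrthonormalBasis ((_ : Fin n) × Fin d) ℝ (Config d n) :=
  Pi.orthonormalBasis fun _ => EuclideanSpace.basisFun (Fin d) ℝ

theorem configBasis_repr (x : Config d n) (i : Fin n) (l : Fin d) :
    (configBasis d n).repr x ⟨i, l⟩ = x i l := by
  exact Pi.orthonormalBasis_repr _ _ _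

/-- Indices of the time-frequency lattice of the configuration space. -/
abbrev LatticeIndex (d n : ℕ) : Type :=
  (((_ : Fin n) × Fin d) → ℤ) × (((_ : Fin n) × Fin d) → ℤ)

/-- The part of a lattice index that belongs to the `i`-th particle. -/
def LatticeIndex.particle (a : LatticeIndex d n) (i : Fin n) : (Fin d → ℤ) × (Fin d → ℤ) :=
  (fun l => a.1 ⟨i, l⟩, fun l => a.2 ⟨i, l⟩)

theorem gaborAtom_configBasis_apply (a : LatticeIndex d n) (x : Config d n) :
    gaborAtom (configBasis d n) a x
      = ∏ i, gaborAtom (EuclideanSpace.basisFun (Fin d) ℝ) (a.particle i) (x i) := by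
  simp only [gaborAtom_apply_eq_prod, Fintype.prod_sigma, configBasis_repr,
    EuclideanSpace.basisFun_repr, LatticeIndex.particle]

theorem latticePoint_configBasis_apply (k : ((_ : Fin n) × Fin d) → ℤ) (i : Fin n) :
    latticePoint (configBasis d n) k i
      = latticePoint (EuclideanSpace.basisFun (Fin d) ℝ) fun l => k ⟨i, l⟩ := by
  ext l
  rw [← configBasis_repr, repr_latticePoint, ← EuclideanSpace.basisFun_repr (Fin d) ℝ,
    repr_latticePoint]

theorem gaborWeight_particle_le (a : LatticeIndex d n) (i : Fin n) :
    gaborWeight (EuclideanSpace.basisFun (Fin d) ℝ) (a.particle i)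
      ≤ gaborWeight (configBasis d n) a := by
  have hle : ∀ k, ‖latticePoint (EuclideanSpace.basisFun (Fin d) ℝ) fun l => k ⟨i, l⟩‖
      ≤ ‖latticePoint (configBasis d n) k‖ := fun k => by
    rw [← latticePoint_configBasis_apply]
    exact PiLp.norm_apply_le _ i
  simp only [gaborWeight, norm_smul]
  gcongr
  exacts [hle a.1, hle a.2]

/-- The one-particle Gabor atoms: scalar Gabor atoms placed in a single component. -/
def particleAtom (α : Fin N) (a : (Fin d → ℤ) × (Fin d → ℤ)) : TestFun d N :=
  ofComponent α (gaborAtom (EuclideanSpace.basisFun (Fin d) ℝ) a)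

theorem exists_particleAtom_bound {p : Seminorm ℂ (TestFun d N)} (hp : Continuous p) :
    ∃ (M : ℕ) (C : ℝ), 0 ≤ C ∧ ∀ (α : Fin N) a, p (particleAtom α a)
      ≤ C * gaborWeight (EuclideanSpace.basisFun (Fin d) ℝ) a ^ M := by
  choose M C hC h using fun α : Fin N => exists_gaborAtom_bound
    (EuclideanSpace.basisFun (Fin d) ℝ) (q := p.comp (ofComponent α).toLinearMap)
    (hp.comp (ofComponent α).continuous)
  refine ⟨∑ α, M α, ∑ α, C α, Finset.sum_nonneg fun α _ => hC α, fun α a => (h α a).trans ?_⟩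
  have hw := one_le_gaborWeight (EuclideanSpace.basisFun (Fin d) ℝ) a
  gcongr
  · exact Finset.sum_nonneg fun α _ => hC α
  · exact Finset.single_le_sum (fun α _ => hC α) (Finset.mem_univ α)
  · exact Finset.single_le_sum (fun α _ => Nat.zero_le _) (Finset.mem_univ α)

/-- Indices of the expansion of the tensor power into product atoms: a tensor component and a
point of the time-frequency lattice. -/
abbrev TensorIndex (d N n : ℕ) : Type := (Fin n → Fin N) × LatticeIndex d n

/-- The one-particle factors of a product atom. -/
def atomFactor (a : TensorIndex d N n) (i : Fin n) : TestFun d N :=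
  particleAtom (a.1 i) (a.2.particle i)

/-- The coefficients of the expansion of the tensor power into product atoms. -/
def tensorCoeff (a : TensorIndex d N n) : TensorTestFun d N n →ₗ[ℂ] ℂ :=
  gaborCoeff (configBasis d n) a.2 ∘ₗ (component a.1).toLinearMap

theorem tensorProd_atomFactor (a : TensorIndex d N n) :
    tensorProd (atomFactor a) = ofComponent a.1 (gaborAtom (configBasis d n) a.2) := by
  ext x β
  rw [tensorProd_apply, ofComponent_apply, gaborAtom_configBasis_apply]
  simp only [atomFactor, particleAtom, ofComponent_apply]
  split_ifs with h
  · exact Finset.prod_congr rfl fun i _ => if_pos (congrFun h i)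
  · obtain ⟨i, hi⟩ := Function.ne_iff.1 h
    exact Finset.prod_eq_zero (Finset.mem_univ i) (if_neg hi)

theorem hasSum_tensorCoeff_smul_tensorProd (f : TensorTestFun d N n) :
    HasSum (fun a : TensorIndex d N n => tensorCoeff a f • tensorProd (atomFactor a)) f := by
  simp only [tensorProd_atomFactor]
  nth_rw 2 [← sum_ofComponent_component f]
  refine hasSum_prod_of_fintype fun α => ?_
  have h := (ofComponent α).hasSum (hasSum_gabor (configBasis d n) (component α f))
  simp only [map_smul] at h
  exact h

theorem summable_gaborWeight_tensorIndex : Summable fun a : TensorIndex d N n =>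
    (gaborWeight (configBasis d n) a.2 ^
      (Fintype.card ((_ : Fin n) × Fin d) + 1))⁻¹ :=
  (hasSum_prod_of_fintype (g := fun a : TensorIndex d N n => (gaborWeight (configBasis d n) a.2 ^
    (Fintype.card ((_ : Fin n) × Fin d) + 1))⁻¹)
    fun _ => (summable_gaborWeight (configBasis d n)).hasSum).summable

theorem exists_tensorCoeff_bound (d N n M : ℕ) :
    ∃ s : Seminorm ℂ (TensorTestFun d N n), Continuous s ∧ ∀ (a : TensorIndex d N n) f,
      ‖tensorCoeff a f‖ ≤ (gaborWeight (configBasis d n) a.2 ^ M)⁻¹ * s f := by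
  obtain ⟨s, hs, hcoeff⟩ := exists_gaborCoeff_bound (configBasis d n) M
  refine ⟨Finset.univ.sup fun α => s.comp (component α).toLinearMap,
    Seminorm.continuous_finsetSup fun α _ =>
      hs.comp (component (E := Config d n) α).continuous, fun a f => (hcoeff a.2 _).trans ?_⟩
  have hw := gaborWeight_pos (configBasis d n) a.2
  gcongr
  exact Finset.le_sup (f := fun α => s.comp (component α).toLinearMap) (Finset.mem_univ a.1) f

theorem exists_prod_atomFactor_bound {p : Seminorm ℂ (TestFun d N)} (hp : Continuous p) (n : ℕ) :
    ∃ (M : ℕ) (C : ℝ), 0 ≤ C ∧ ∀ a : TensorIndex d N n,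
      ∏ i, p (atomFactor a i) ≤ C * gaborWeight (configBasis d n) a.2 ^ M := by
  obtain ⟨M, C, hC, hatom⟩ := exists_particleAtom_bound hp
  refine ⟨M * n, C ^ n, pow_nonneg hC n, fun a => ?_⟩
  calc ∏ i, p (atomFactor a i) ≤ ∏ _i : Fin n, C * gaborWeight (configBasis d n) a.2 ^ M := by
        refine Finset.prod_le_prod (fun i _ => apply_nonneg _ _) fun i _ => (hatom _ _).trans ?_
        gcongr
        · exact (gaborWeight_pos _ _).le
        · exact gaborWeight_particle_le a.2 i
    _ = C ^ n * gaborWeight (configBasis d n) a.2 ^ (M * n) := by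
        rw [Finset.prod_const, Finset.card_fin, mul_pow, pow_mul]

theorem exists_tensorCoeff_mul_prod_bound {p : Seminorm ℂ (TestFun d N)} (hp : Continuous p)
    (n K : ℕ) : ∃ s : Seminorm ℂ (TensorTestFun d N n), Continuous s ∧
      ∀ (a : TensorIndex d N n) f, ‖tensorCoeff a f‖ * ∏ i, p (atomFactor a i) ≤
        (gaborWeight (configBasis d n) a.2 ^ K)⁻¹ * s f := by
  obtain ⟨M, C, hC, hatom⟩ := exists_prod_atomFactor_bound hp n
  obtain ⟨s, hs, hcoeff⟩ := exists_tensorCoeff_bound d N n (K + M)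
  lift C to NNReal using hC
  refine ⟨C • s, hs.const_smul C, fun a f => ?_⟩
  have hw := gaborWeight_pos (configBasis d n) a.2
  calc ‖tensorCoeff a f‖ * ∏ i, p (atomFactor a i)
      ≤ ((gaborWeight (configBasis d n) a.2 ^ (K + M))⁻¹ * s f) *
          (C * gaborWeight (configBasis d n) a.2 ^ M) :=
        mul_le_mul (hcoeff a f) (hatom a) (Finset.prod_nonneg fun i _ => apply_nonneg _ _)
          (mul_nonneg (by positivity) (apply_nonneg _ _))
    _ = _ := by
        rw [smul_apply, NNReal.smul_def, smul_eq_mul, pow_add]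
        field_simp

end TensorExpansion

section HilbertSeminorm

variable {V : Type*} [AddCommGroup V] [Module ℂ V]

/-- The semi-inner product pulled back along a linear map into an inner product space; it witnesses
that the pulled back norm is a Hilbert seminorm. -/
abbrev pullbackCore {H : Type*} [NormedAddCommGroup H] [InnerProductSpace ℂ H] (Φ : V →ₗ[ℂ] H) :
    PreInnerProductSpace.Core ℂ V where
  inner f g := inner ℂ (Φ f) (Φ g)
  conj_inner_symm f g := inner_conj_symm _ _
  re_inner_nonneg f := inner_self_nonneg
  add_left f g h := by rw [map_add, inner_add_left]
  smul_left f g c := by rw [map_smul, inner_smul_left]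

/-- A semi-inner product scaled by `r ≥ 0`. -/
abbrev smulCore (r : NNReal) (c : PreInnerProductSpace.Core ℂ V) :
    PreInnerProductSpace.Core ℂ V where
  inner f g := (r : ℂ) * c.inner f g
  conj_inner_symm f g := by simp [c.conj_inner_symm]
  re_inner_nonneg f := by
    have := mul_nonneg r.2 (c.re_inner_nonneg f)
    simpa using this
  add_left f g h := by simp only [c.add_left, mul_add]
  smul_left f g z := by simp only [c.smul_left, mul_left_comm]

/-- A family of functionals whose values on every vector are square-summable, as a linear map
into `ℓ²`. -/
def toLpTwo {A : Type*} (ψ : A → V →ₗ[ℂ] ℂ) (hψ : ∀ f, Memℓp (fun a => ψ a f) 2) :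
    V →ₗ[ℂ] lp (fun _ : A => ℂ) 2 where
  toFun f := ⟨fun a => ψ a f, hψ f⟩
  map_add' f g := by ext a; exact map_add (ψ a) f g
  map_smul' c f := by ext a; exact map_smul (ψ a) c f

theorem hasSum_norm_toLpTwo_sq {A : Type*} (ψ : A → V →ₗ[ℂ] ℂ)
    (hψ : ∀ f, Memℓp (fun a => ψ a f) 2) (f : V) :
    HasSum (fun a => ‖ψ a f‖ ^ 2) (‖toLpTwo ψ hψ f‖ ^ 2) := by
  have h := lp.hasSum_norm (p := 2) (by norm_num) (toLpTwo ψ hψ f)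
  simp only [ENNReal.toReal_ofNat, Real.rpow_two] at h
  exact h

variable [TopologicalSpace V]

theorem isHilbertSeminorm_comp {H : Type*} [NormedAddCommGroup H] [InnerProductSpace ℂ H]
    (Φ : V →ₗ[ℂ] H) (hΦ : Continuous ((normSeminorm ℂ H).comp Φ)) :
    IsHilbertSeminorm ((normSeminorm ℂ H).comp Φ) where
  continuous := hΦ
  exists_inner := ⟨pullbackCore Φ, fun f => (inner_self_eq_norm_sq (𝕜 := ℂ) (Φ f)).symm⟩

theorem IsHilbertSeminorm.smul {q : Seminorm ℂ V} (hq : IsHilbertSeminorm q) (r : NNReal) :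
    IsHilbertSeminorm (r • q) where
  continuous := hq.continuous.const_smul r
  exists_inner := by
    obtain ⟨c, hc⟩ := hq.exists_inner
    refine ⟨smulCore (r ^ 2) c, fun f => ?_⟩
    change (r * q f) ^ 2 = (((r ^ 2 : NNReal) : ℂ) * c.inner f f).re
    rw [mul_pow, hc f, ← NNReal.coe_pow]
    exact (Complex.re_ofReal_mul _ _).symm

variable [IsTopologicalAddGroup V] {A : Type*}

theorem exists_hilbertSeminorm_sq_hasSum (ψ : A → V →ₗ[ℂ] ℂ) {μ : A → ℝ} (hμ : Summable μ)
    {s : Seminorm ℂ V} (hs : Continuous s) (hψ : ∀ a f, ‖ψ a f‖ ^ 2 ≤ μ a * s f ^ 2) :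
    ∃ q : Seminorm ℂ V, IsHilbertSeminorm q ∧ ∀ f, HasSum (fun a => ‖ψ a f‖ ^ 2) (q f ^ 2) := by
  have hmem : ∀ f, Memℓp (fun a => ψ a f) 2 := fun f => memℓp_gen <| by
    simpa only [ENNReal.toReal_ofNat, Real.rpow_two] using
      Summable.of_nonneg_of_le (fun a => by positivity) (fun a => hψ a f) (hμ.mul_right _)
  refine ⟨(normSeminorm ℂ _).comp (toLpTwo ψ hmem), isHilbertSeminorm_comp _ ?_,
    hasSum_norm_toLpTwo_sq ψ hmem⟩
  obtain ⟨r, hr⟩ : ∃ r : NNReal, (r : ℝ) = √(∑' a, μ a) := ⟨⟨_, Real.sqrt_nonneg _⟩, rfl⟩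
  refine Seminorm.continuous_of_le (q := r • s) (hs.const_smul r) fun f => ?_
  have hsq : ‖toLpTwo ψ hmem f‖ ^ 2 ≤ (∑' a, μ a) * s f ^ 2 :=
    hasSum_le (hψ · f) (hasSum_norm_toLpTwo_sq ψ hmem f) (hμ.hasSum.mul_right _)
  calc ‖toLpTwo ψ hmem f‖ ≤ √((∑' a, μ a) * s f ^ 2) := Real.le_sqrt_of_sq_le hsq
    _ = √(∑' a, μ a) * s f := by
        rw [Real.sqrt_mul' _ (sq_nonneg _), Real.sqrt_sq (apply_nonneg _ _)]
    _ = (r • s) f := by rw [← hr]; rfl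

theorem exists_hilbertSeminorm_tsum_le (φ : A → V →ₗ[ℂ] ℂ) {μ : A → ℝ} (hμ0 : ∀ a, 0 < μ a)
    (hμ : Summable μ) {s : Seminorm ℂ V} (hs : Continuous s) (hφ : ∀ a f, ‖φ a f‖ ≤ μ a * s f) :
    ∃ q : Seminorm ℂ V, IsHilbertSeminorm q ∧
      ∀ f, Summable (fun a => ‖φ a f‖) ∧ ∑' a, ‖φ a f‖ ≤ q f := by
  let ψ : A → V →ₗ[ℂ] ℂ := fun a => ((√(μ a))⁻¹ : ℂ) • φ a
  have hψ : ∀ a f, ‖ψ a f‖ = (√(μ a))⁻¹ * ‖φ a f‖ := fun a f => by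
    simp [ψ, abs_of_nonneg (Real.sqrt_nonneg _)]
  obtain ⟨q, hq, hsum⟩ := exists_hilbertSeminorm_sq_hasSum ψ hμ hs fun a f => by
    rw [hψ, mul_pow, inv_pow, Real.sq_sqrt (hμ0 a).le, inv_mul_le_iff₀ (hμ0 a), ← mul_assoc, ← sq,
      ← mul_pow]
    exact pow_le_pow_left₀ (norm_nonneg _) (hφ a f) 2
  obtain ⟨r, hr⟩ : ∃ r : NNReal, (r : ℝ) = √(∑' a, μ a) := ⟨⟨_, Real.sqrt_nonneg _⟩, rfl⟩
  refine ⟨r • q, hq.smul r, fun f => ?_⟩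
  have hsummable : Summable fun a => ‖φ a f‖ :=
    .of_nonneg_of_le (fun a => norm_nonneg _) (hφ · f) (hμ.mul_right _)
  refine ⟨hsummable, hsummable.tsum_le_of_sum_le fun u => ?_⟩
  calc ∑ a ∈ u, ‖φ a f‖ = ∑ a ∈ u, √(μ a) * ‖ψ a f‖ := Finset.sum_congr rfl fun a _ => by
        rw [hψ, mul_inv_cancel_left₀ (Real.sqrt_pos.2 (hμ0 a)).ne']
    _ ≤ √(∑ a ∈ u, √(μ a) ^ 2) * √(∑ a ∈ u, ‖ψ a f‖ ^ 2) := Real.sum_mul_le_sqrt_mul_sqrt u _ _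
    _ ≤ √(∑' a, μ a) * √(q f ^ 2) := by
        gcongr
        · simp only [Real.sq_sqrt (hμ0 _).le]
          exact hμ.sum_le_tsum _ fun a _ => (hμ0 a).le
        · exact sum_le_hasSum _ (fun a _ => by positivity) (hsum f)
    _ = √(∑' a, μ a) * q f := by rw [Real.sqrt_sq (apply_nonneg _ _)]
    _ = (r • q) f := by rw [← hr]; rfl

end HilbertSeminorm

section Outer

variable {E E₁ E₂ F₁ F₂ G : Type*}
  [NormedAddCommGroup E] [NormedSpace ℝ E] [FiniteDimensional ℝ E]
  [NormedAddCommGroup E₁] [NormedSpace ℝ E₁] [NormedAddCommGroup E₂] [NormedSpace ℝ E₂]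
  [NormedAddCommGroup F₁] [NormedSpace ℝ F₁] [NormedAddCommGroup F₂] [NormedSpace ℝ F₂]
  [NormedAddCommGroup G] [NormedSpace ℝ G]

theorem exists_norm_le_one_add_mul_one_add (P : E →L[ℝ] E₁) (Q : E →L[ℝ] E₂)
    (hPQ : ∀ x, P x = 0 → Q x = 0 → x = 0) :
    ∃ K : ℝ, 0 ≤ K ∧ ∀ x, ‖x‖ ≤ K * ((1 + ‖P x‖) * (1 + ‖Q x‖)) := by
  obtain ⟨K, hK0, hK⟩ := exists_norm_le_of_ker P Q hPQ
  refine ⟨K, hK0, fun x => (hK x).trans (mul_le_mul_of_nonneg_left ?_ hK0)⟩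
  have := mul_nonneg (norm_nonneg (P x)) (norm_nonneg (Q x))
  exact max_le (by linarith [norm_nonneg (Q x)]) (by linarith [norm_nonneg (P x)])

theorem norm_iteratedFDeriv_outer_le (P : E →L[ℝ] E₁) (Q : E →L[ℝ] E₂)
    (hPQ : ∀ x, P x = 0 → Q x = 0 → x = 0) (B : F₁ →L[ℝ] F₂ →L[ℝ] G) (f : 𝓢(E₁, F₁))
    (h : 𝓢(E₂, F₂)) (l : ℕ) (x : E) :
    ‖iteratedFDeriv ℝ l (outer P Q hPQ B f h) x‖ ≤ ‖B‖ * ∑ i ∈ Finset.range (l + 1),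
      l.choose i * (‖iteratedFDeriv ℝ i f (P x)‖ * ‖P‖ ^ i) *
        (‖iteratedFDeriv ℝ (l - i) h (Q x)‖ * ‖Q‖ ^ (l - i)) := by
  refine (B.norm_iteratedFDeriv_le_of_bilinear (N := ∞)
    (f := fun x => f (P x)) (g := fun x => h (Q x)) ((f.smooth ⊤).comp P.contDiff)
    ((h.smooth ⊤).comp Q.contDiff) x (n := l) (mod_cast le_top)).trans ?_
  gcongr
  · exact norm_iteratedFDeriv_comp_le P f _ x
  · exact norm_iteratedFDeriv_comp_le Q h _ x

variable [NormedSpace ℂ F₁] [SMulCommClass ℝ ℂ F₁] [NormedSpace ℂ F₂] [SMulCommClass ℝ ℂ F₂]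

theorem weighted_leibniz_term_le (f : 𝓢(E₁, F₁)) (h : 𝓢(E₂, F₂)) (k : ℕ) {i l : ℕ} (hi : i ≤ l)
    {a b : ℝ} (ha : 0 ≤ a) (hb : 0 ≤ b) (y : E₁) (z : E₂) :
    ((1 + ‖y‖) * (1 + ‖z‖)) ^ k * (l.choose i * (‖iteratedFDeriv ℝ i f y‖ * a ^ i) *
        (‖iteratedFDeriv ℝ (l - i) h z‖ * b ^ (l - i)))
      ≤ (2 ^ k * supSeminorm E₁ F₁ (k, l) f) * (2 ^ k * supSeminorm E₂ F₂ (k, l) h) *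
        (a ^ i * b ^ (l - i) * l.choose i) := by
  have hf := one_add_pow_mul_le_supSeminorm (m := (k, l)) le_rfl hi f y
  have hh := one_add_pow_mul_le_supSeminorm (m := (k, l)) le_rfl (Nat.sub_le l i) h z
  calc _ = (((1 + ‖y‖) ^ k * ‖iteratedFDeriv ℝ i f y‖) *
        ((1 + ‖z‖) ^ k * ‖iteratedFDeriv ℝ (l - i) h z‖)) *
          (a ^ i * b ^ (l - i) * l.choose i) := by rw [mul_pow]; ring
    _ ≤ _ := by gcongr

variable [NormedSpace ℂ G] [SMulCommClass ℝ ℂ G]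

theorem exists_seminorm_outer_le (P : E →L[ℝ] E₁) (Q : E →L[ℝ] E₂)
    (hPQ : ∀ x, P x = 0 → Q x = 0 → x = 0) (B : F₁ →L[ℝ] F₂ →L[ℝ] G) (m : ℕ × ℕ) :
    ∃ C : NNReal, ∀ (f : 𝓢(E₁, F₁)) (h : 𝓢(E₂, F₂)),
      SchwartzMap.seminorm ℂ m.1 m.2 (outer P Q hPQ B f h)
        ≤ C * (supSeminorm E₁ F₁ m f * supSeminorm E₂ F₂ m h) := by
  obtain ⟨K, hK0, hK⟩ := exists_norm_le_one_add_mul_one_add P Q hPQ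
  lift K to NNReal using hK0
  obtain ⟨k, l⟩ := m
  refine ⟨‖B‖₊ * K ^ k * (‖P‖₊ + ‖Q‖₊) ^ l * (2 ^ k * 2 ^ k), fun f h =>
    SchwartzMap.seminorm_le_bound ℂ k l _ (by positivity) fun x => ?_⟩
  push_cast
  calc ‖x‖ ^ k * ‖iteratedFDeriv ℝ l (outer P Q hPQ B f h) x‖
      ≤ (K * ((1 + ‖P x‖) * (1 + ‖Q x‖))) ^ k * (‖B‖ * ∑ i ∈ Finset.range (l + 1),
        l.choose i * (‖iteratedFDeriv ℝ i f (P x)‖ * ‖P‖ ^ i) *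
          (‖iteratedFDeriv ℝ (l - i) h (Q x)‖ * ‖Q‖ ^ (l - i))) := by
        gcongr
        · exact hK x
        · exact norm_iteratedFDeriv_outer_le P Q hPQ B f h l x
    _ = ‖B‖ * K ^ k * ∑ i ∈ Finset.range (l + 1), ((1 + ‖P x‖) * (1 + ‖Q x‖)) ^ k *
        (l.choose i * (‖iteratedFDeriv ℝ i f (P x)‖ * ‖P‖ ^ i) *
          (‖iteratedFDeriv ℝ (l - i) h (Q x)‖ * ‖Q‖ ^ (l - i))) := by
        rw [← Finset.mul_sum, mul_pow (K : ℝ)]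
        ring
    _ ≤ ‖B‖ * K ^ k * ((2 ^ k * supSeminorm E₁ F₁ (k, l) f) *
        (2 ^ k * supSeminorm E₂ F₂ (k, l) h) * (‖P‖ + ‖Q‖) ^ l) := by
        refine mul_le_mul_of_nonneg_left ?_ (by positivity)
        rw [add_pow, Finset.mul_sum]
        exact Finset.sum_le_sum fun i hi => weighted_leibniz_term_le f h k
          (Finset.mem_range_succ_iff.1 hi) (norm_nonneg P) (norm_nonneg Q) (P x) (Q x)
    _ = _ := by ring

end Outer

theorem continuous_of_seminorm_le {E E' F F' : Type*} [NormedAddCommGroup E] [NormedSpace ℝ E]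
    [NormedAddCommGroup E'] [NormedSpace ℝ E'] [NormedAddCommGroup F] [NormedSpace ℝ F]
    [NormedSpace ℂ F] [SMulCommClass ℝ ℂ F] [NormedAddCommGroup F'] [NormedSpace ℝ F']
    [NormedSpace ℂ F'] [SMulCommClass ℝ ℂ F'] (T : 𝓢(E, F) →ₗ[ℂ] 𝓢(E', F'))
    (hT : ∀ k : ℕ × ℕ, ∃ C : ℝ, 0 ≤ C ∧ ∀ f,
      SchwartzMap.seminorm ℂ k.1 k.2 (T f) ≤ C * supSeminorm E F k f) : Continuous T :=
  WithSeminorms.continuous_of_isBounded (schwartz_withSeminorms ℂ E F)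
    (schwartz_withSeminorms ℂ E' F') T fun k =>
      (hT k).elim fun C hC => ⟨Finset.Iic k, ⟨C, hC.1⟩, hC.2⟩

section Tensor

variable {d N n m : ℕ}

theorem tensor_tensorProd (f : Fin n → TestFun d N) (g : Fin m → TestFun d N) :
    tensor (tensorProd f) (tensorProd g) = tensorProd (Fin.append f g) := by
  ext x α
  rw [tensor_apply, tensorProd_apply, tensorProd_apply, tensorProd_apply, Fin.prod_univ_add]
  simp only [Fin.append_left, Fin.append_right]

/-- The tensor product as a bilinear map. -/
def tensorBilin (d N n m : ℕ) :
    TensorTestFun d N n →ₗ[ℂ] TensorTestFun d N m →ₗ[ℂ] TensorTestFun d N (n + m) :=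
  LinearMap.mk₂ ℂ tensor
    (fun f g h => by ext x α; simp [tensor_apply, add_mul])
    (fun c f h => by ext x α; simp [tensor_apply, mul_assoc])
    (fun f g h => by ext x α; simp [tensor_apply, mul_add])
    (fun c f h => by ext x α; simp [tensor_apply, mul_left_comm])

theorem exists_seminorm_tensor_le (d N n m : ℕ) (k : ℕ × ℕ) :
    ∃ C : NNReal, ∀ (f : TensorTestFun d N n) (h : TensorTestFun d N m),
      SchwartzMap.seminorm ℂ k.1 k.2 (tensor f h)
        ≤ C * (supSeminorm (Config d n) (Coeff N n) k f *
          supSeminorm (Config d m) (Coeff N m) k h) := by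
  unfold tensor
  exact exists_seminorm_outer_le _ _ _ _ k

theorem continuous_tensorBilin_apply (f : TensorTestFun d N n) :
    Continuous (tensorBilin d N n m f) :=
  continuous_of_seminorm_le _ fun k => by
    obtain ⟨C, hC⟩ := exists_seminorm_tensor_le d N n m k
    exact ⟨C * supSeminorm _ _ k f, mul_nonneg C.2 (apply_nonneg _ _), fun h =>
      (hC f h).trans_eq (mul_assoc _ _ _).symm⟩

theorem continuous_tensorBilin_flip_apply (h : TensorTestFun d N m) :
    Continuous ((tensorBilin d N n m).flip h) :=
  continuous_of_seminorm_le _ fun k => by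
    obtain ⟨C, hC⟩ := exists_seminorm_tensor_le d N n m k
    exact ⟨C * supSeminorm _ _ k h, mul_nonneg C.2 (apply_nonneg _ _), fun f =>
      (hC f h).trans_eq (by rw [mul_right_comm, mul_assoc])⟩

/-- The continuous linear map `h ↦ f ⊗ h`, which freezes the left factor of a functional. -/
def tensorRight (f : TensorTestFun d N n) : TensorTestFun d N m →L[ℂ] TensorTestFun d N (n + m) :=
  ⟨tensorBilin d N n m f, continuous_tensorBilin_apply f⟩

/-- The continuous linear map `f ↦ f ⊗ h`, which freezes the right factor of a functional. -/
def tensorLeft (h : TensorTestFun d N m) : TensorTestFun d N n →L[ℂ] TensorTestFun d N (n + m) :=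
  ⟨(tensorBilin d N n m).flip h, continuous_tensorBilin_flip_apply h⟩

end Tensor

section ProductBound

variable {d N : ℕ}

theorem exists_hilbertSeminorm_bound {p : Seminorm ℂ (TestFun d N)} (hp : Continuous p) (n : ℕ) :
    ∃ q : Seminorm ℂ (TensorTestFun d N n), IsHilbertSeminorm q ∧
      ∀ (L : TensorTestFun d N n →L[ℂ] ℂ) (C : ℝ), 0 ≤ C →
        (∀ g : Fin n → TestFun d N, ‖L (tensorProd g)‖ ≤ C * ∏ i, p (g i)) →
          ∀ f, ‖L f‖ ≤ C * q f := by
  have hprod : ∀ a : TensorIndex d N n, 0 ≤ ∏ i, p (atomFactor a i) := fun a =>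
    Finset.prod_nonneg fun i _ => apply_nonneg _ _
  let φ : TensorIndex d N n → TensorTestFun d N n →ₗ[ℂ] ℂ := fun a =>
    ((∏ i, p (atomFactor a i) : ℝ) : ℂ) • tensorCoeff a
  have hφ : ∀ a f, ‖φ a f‖ = ‖tensorCoeff a f‖ * ∏ i, p (atomFactor a i) := fun a f => by
    rw [LinearMap.smul_apply, norm_smul, Complex.norm_of_nonneg (hprod a), mul_comm]
  obtain ⟨s, hs, hbound⟩ := exists_tensorCoeff_mul_prod_bound hp n
    (Fintype.card ((_ : Fin n) × Fin d) + 1)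
  obtain ⟨q, hq, hqφ⟩ := exists_hilbertSeminorm_tsum_le φ
    (fun a => inv_pos.2 (pow_pos (gaborWeight_pos (configBasis d n) a.2) _))
    summable_gaborWeight_tensorIndex hs fun a f => (hφ a f).trans_le (hbound a f)
  refine ⟨q, hq, fun L C hC hL f => ?_⟩
  have hterm : ∀ a, ‖L (tensorCoeff a f • tensorProd (atomFactor a))‖ ≤ C * ‖φ a f‖ := fun a => by
    rw [map_smul, norm_smul, hφ, mul_left_comm]
    exact mul_le_mul_of_nonneg_left (hL _) (norm_nonneg _)
  calc ‖L f‖ ≤ C * ∑' a, ‖φ a f‖ :=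
        (L.hasSum (hasSum_tensorCoeff_smul_tensorProd f)).norm_le_of_bounded
          ((hqφ f).1.hasSum.mul_left C) hterm
    _ ≤ C * q f := mul_le_mul_of_nonneg_left (hqφ f).2 hC

theorem exists_nnreal_le_mul (C : ℕ → ℝ) :
    ∃ K : ℕ → NNReal, ∀ n m, C (n + m) ≤ K n * K m := by
  let K : ℕ → NNReal := fun n => 1 + ∑ k ∈ Finset.range (2 * n + 1), ‖C k‖₊
  have hK : ∀ n, 1 ≤ K n := fun n => le_self_add
  have hCK : ∀ k n, k ≤ 2 * n → ‖C k‖₊ ≤ K n := fun k n hk =>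
    (Finset.single_le_sum (f := fun k => ‖C k‖₊) (fun _ _ => zero_le)
      (Finset.mem_range_succ_iff.2 hk)).trans le_add_self
  suffices h : ∀ n m, ‖C (n + m)‖₊ ≤ K n * K m from
    ⟨K, fun n m => (le_abs_self _).trans (NNReal.coe_le_coe.2 (h n m))⟩
  intro n m
  rcases le_total n m with h | h
  · exact (hCK (n + m) m (by omega)).trans (le_mul_of_one_le_left' (hK n))
  · exact (hCK (n + m) n (by omega)).trans (le_mul_of_one_le_right' (hK m))

theorem hilbertSpaceStructureCondition_of_bound {W : ∀ n, TensorTestFun d N n →L[ℂ] ℂ}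
    {p : Seminorm ℂ (TestFun d N)} (hp : Continuous p) {C : ℕ → ℝ}
    (hW : ∀ n (f : Fin n → TestFun d N), ‖W n (tensorProd f)‖ ≤ C n * ∏ i, p (f i)) :
    HilbertSpaceStructureCondition W := by
  obtain ⟨K, hCK⟩ := exists_nnreal_le_mul C
  choose q hq hqL using exists_hilbertSeminorm_bound (d := d) (N := N) hp
  refine ⟨fun n => K n • q n, fun n => (hq n).smul (K n), fun n m f h => ?_⟩
  have hp0 : ∀ {k : ℕ} (g : Fin k → TestFun d N), 0 ≤ ∏ i, p (g i) := fun g =>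
    Finset.prod_nonneg fun i _ => apply_nonneg _ _
  have hprod : ∀ (g : Fin n → TestFun d N) (g' : Fin m → TestFun d N),
      ‖W (n + m) (tensor (tensorProd g) (tensorProd g'))‖
        ≤ K n * K m * (∏ i, p (g i)) * ∏ i, p (g' i) := fun g g' => by
    rw [tensor_tensorProd, mul_assoc]
    refine (hW (n + m) _).trans ?_
    simp only [Fin.prod_univ_add, Fin.append_left, Fin.append_right]
    exact mul_le_mul_of_nonneg_right (hCK n m) (mul_nonneg (hp0 g) (hp0 g'))
  have hright : ∀ g : Fin n → TestFun d N,
      ‖W (n + m) (tensor (tensorProd g) h)‖ ≤ K n * K m * (∏ i, p (g i)) * q m h := fun g =>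
    hqL m ((W (n + m)).comp (tensorRight (tensorProd g))) _
      (mul_nonneg (by positivity) (hp0 g)) (hprod g) h
  calc ‖W (n + m) (tensor f h)‖ ≤ K n * K m * q m h * q n f :=
        hqL n ((W (n + m)).comp (tensorLeft h)) _ (mul_nonneg (by positivity) (apply_nonneg _ _))
          (fun g => (hright g).trans_eq (mul_right_comm _ _ _)) f
    _ = (K n * q n f) * (K m * q m h) := by ring

end ProductBound

section Truncation

variable {d N n : ℕ} {p : Seminorm ℂ (TestFun d N)}

theorem sum_norm_mul_prod_nonneg {k : ℕ} (p : Seminorm ℂ (TestFun d N)) (c : Fin k → ℂ)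
    (f : Fin k → Fin n → TestFun d N) : 0 ≤ ∑ j, ‖c j‖ * ∏ i, p (f j i) :=
  Finset.sum_nonneg fun _ _ => mul_nonneg (norm_nonneg _)
    (Finset.prod_nonneg fun _ _ => apply_nonneg _ _)

theorem tensorNorm_tensorProd_le (p : Seminorm ℂ (TestFun d N)) (f : Fin n → TestFun d N) :
    tensorNorm p (tensorProd f) ≤ ∏ i, p (f i) := by
  refine csInf_le ⟨0, ?_⟩ ⟨1, fun _ => 1, fun _ => f, by simp, by simp⟩
  rintro r ⟨k, c, g, -, rfl⟩
  exact sum_norm_mul_prod_nonneg p c g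

theorem tensorNorm_nonneg (p : Seminorm ℂ (TestFun d N)) (F : TensorTestFun d N n) :
    0 ≤ tensorNorm p F := by
  refine Real.sInf_nonneg ?_
  rintro r ⟨k, c, g, -, rfl⟩
  exact sum_norm_mul_prod_nonneg p c g

theorem ContinuousForTensorNorm.exists_bound {T : TensorTestFun d N n →L[ℂ] ℂ}
    (hT : ContinuousForTensorNorm p T) :
    ∃ C : ℝ, ∀ f : Fin n → TestFun d N, ‖T (tensorProd f)‖ ≤ C * ∏ i, p (f i) := by
  obtain ⟨C, hC⟩ := hT
  refine ⟨|C|, fun f => ?_⟩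
  calc ‖T (tensorProd f)‖ ≤ C * tensorNorm p (tensorProd f) :=
        hC _ (Submodule.subset_span ⟨f, rfl⟩)
    _ ≤ |C| * tensorNorm p (tensorProd f) :=
        mul_le_mul_of_nonneg_right (le_abs_self C) (tensorNorm_nonneg p _)
    _ ≤ _ := mul_le_mul_of_nonneg_left (tensorNorm_tensorProd_le p f) (abs_nonneg C)

theorem prod_parts_prod_orderEmbOfFin {M : Type*} [CommMonoid M]
    (I : Finpartition (Finset.univ : Finset (Fin n))) (u : Fin n → M) :
    ∏ b ∈ I.parts, ∏ i, u (b.orderEmbOfFin rfl i) = ∏ i, u i := by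
  have hblock : ∀ b : Finset (Fin n), ∏ i, u (b.orderEmbOfFin rfl i) = ∏ i ∈ b, u i := fun b => by
    conv_rhs => rw [← Finset.map_orderEmbOfFin_univ b rfl, Finset.prod_map]
    rfl
  simp only [hblock]
  exact (Finset.prod_biUnion I.disjoint).symm.trans (by rw [I.biUnion_parts])

theorem IsTruncationOf.exists_bound {W WT : ∀ n, TensorTestFun d N n →L[ℂ] ℂ}
    (hWT : IsTruncationOf WT W) (hp : ∀ n, 1 ≤ n → ContinuousForTensorNorm p (WT n)) (n : ℕ) :
    ∃ C : ℝ, ∀ f : Fin n → TestFun d N, ‖W n (tensorProd f)‖ ≤ C * ∏ i, p (f i) := by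
  rcases Nat.eq_zero_or_pos n with rfl | hn
  · refine ⟨‖W 0 (tensorProd Fin.elim0)‖, fun f => ?_⟩
    rw [Subsingleton.elim f Fin.elim0, Finset.prod_of_isEmpty, mul_one]
  choose! C hC using fun l (hl : 1 ≤ l) => (hp l hl).exists_bound
  refine ⟨∑ I : Finpartition (Finset.univ : Finset (Fin n)), ∏ b ∈ I.parts, C b.card, fun f => ?_⟩
  rw [hWT n hn f, Finset.sum_mul]
  refine (norm_sum_le _ _).trans (Finset.sum_le_sum fun I _ => ?_)
  rw [norm_prod, ← prod_parts_prod_orderEmbOfFin I, ← Finset.prod_mul_distrib]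
  exact Finset.prod_le_prod (fun b _ => norm_nonneg _) fun b hb =>
    hC _ (Finset.card_pos.2 (I.nonempty_of_mem_parts hb)) _

theorem theorem1_general {W WT : ∀ n, TensorTestFun d N n →L[ℂ] ℂ} (hWT : IsTruncationOf WT W)
    (hcont : ∃ p : Seminorm ℂ (TestFun d N), Continuous p ∧
      ∀ n, 1 ≤ n → ContinuousForTensorNorm p (WT n)) : HilbertSpaceStructureCondition W := by
  obtain ⟨p, hp, hpT⟩ := hcont
  choose C hC using hWT.exists_bound hpT
  exact hilbertSpaceStructureCondition_of_bound hp hC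

end Truncation

end Wightman

end

theorem theorem1 (d N : ℕ) (W WT : ∀ n, Wightman.TensorTestFun d N n →L[ℂ] ℂ)
    (hWT : Wightman.IsTruncationOf WT W)
    (hcont : ∃ p : Seminorm ℂ (Wightman.TestFun d N), Wightman.IsSchwartzNorm p ∧
      ∀ n, 1 ≤ n → Wightman.ContinuousForTensorNorm p (WT n)) :
    Wightman.HilbertSpaceStructureCondition W :=
  Wightman.theorem1_general hWT (hcont.imp fun _ hp => ⟨hp.1.continuous, hp.2⟩)
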